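/- Conventions. Multisets are finite and averages $\mathbb{E}_{a\in A}$ and sumsets $A+B=\{a+b : a\in A, b\in B\}$ are taken counting multiplicity. Let $G$ be an at most countable additive (abelian) group. A coset progression $Q$ of rank $k\ge 0$ in $G$ consists of a finite subgroup $H\le G$ (viewed as a multiset in which all elements have the same positive multiplicity), elements $v_1,\dots,v_k\in G$ and real numbers $N_1,\dots,N_k>0$, and denotes the multiset $$Q = H+\{n_1v_1+\dots+n_kv_k : n_i\in\mathbb{Z},\ |n_i|\le N_i \text{ for all } i\};$$ for $\varepsilon>0$ the dilate $\varepsilon Q$ is the coset progression with the same $H$ and $v_i$, and with $N_i$ replaced by $\varepsilon N_i$. A $G$-system is a probability space $\mathrm{X}=(X,\mathcal{B},\mu)$, countably generated modulo null sets, with invertible measure-preserving maps $T^g\colon X\to X$ $(g\in G)$ such that $T^0=\mathrm{id}$ and $T^{g+h}=T^gT^h$; write $T^gf=f\circ T^{-g}$. For $f\in L^\infty(\mathrm{X})$ (complex-valued), an integer $d\ge1$ and a non-empty finite multiset $Q$ in $G$, the Gowers uniformity seminorm $\|f\|_{U^d_Q(\mathrm{X})}\ge 0$ is defined by $$\|f\|_{U^d_Q(\mathrm{X})}^{2^d}=\mathbb{E}_{h_1,\dots,h_d,h_1',\dots,h_d'\in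 Q}\int_X \Delta_{h_1,h_1'}\cdots\Delta_{h_d,h_d'}f\,d\mu,\qquad \Delta_{h,h'}f=(T^hf)\overline{(T^{h'}f)}.$$ Theorem 1.16 (Qualitative Bessel inequality for uniformity norms). For all integers $r\ge 0$ and $d\ge 1$ there is a function $c\colon(0,+\infty)\to(0,+\infty)$ with $c(\varepsilon)\to0$ as $\varepsilon\to0$, depending only on $r$ and $d$, such that the following holds. Let $G$ be an at most countable additive group, let $\mathrm{X}$ be a $G$-system, let $(Q_i)_{i\in I}$ be a finite non-empty family of coset progressions in $G$, all of rank at most $r$, and let $f\in L^\infty(\mathrm{X})$ with $\|f\|_{L^\infty(\mathrm{X})}\le1$. If, for some $\varepsilon>0$, $$\mathbb{E}_{i,j\in I}\|f\|_{U^{2d-1}_{\varepsilon Q_i+\varepsilon Q_j}(\mathrm{X})}\le\varepsilon,$$ then $$\mathbb{E}_{i\in I}\|f\|_{U^{d}_{Q_i}(\mathrm{X})}\le c(\varepsilon).$$ In particular, $c$ does not depend on $|I|$. -/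

import Mathlib

open scoped BigOperators Topology
open MeasureTheory Filter

noncomputable section

/-- The average of `F` over a finite multiset `A`, elements being counted with multiplicity. -/
def multisetAvg {G : Type*} (A : Multiset G) (F : G → ℂ) : ℂ :=
  (A.map F).sum / (Multiset.card A : ℂ)

theorem integral_multisetAvg {G X : Type*} [MeasurableSpace X] {μ : Measure X} (A : Multiset G)
    (F : G → X → ℂ) (hF : ∀ h, Integrable (F h) μ) :
    Integrable (fun x => multisetAvg A fun h => F h x) μ ∧
      ∫ x, (multisetAvg A fun h => F h x) ∂μ = multisetAvg A fun h => ∫ x, F h x ∂μ := by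
  have key : ∀ B : Multiset G, Integrable (fun x => (B.map fun h => F h x).sum) μ ∧
      ∫ x, (B.map fun h => F h x).sum ∂μ = (B.map fun h => ∫ x, F h x ∂μ).sum := by
    intro B
    induction B using Multiset.induction with
    | empty => simp
    | cons a B ih =>
      simp only [Multiset.map_cons, Multiset.sum_cons]
      exact ⟨(hF a).add ih.1, by rw [integral_add (hF a) ih.1, ih.2]⟩
  simp only [multisetAvg]
  exact ⟨(key A).1.div_const _, by rw [integral_div, (key A).2]⟩

theorem multisetAvg_nonneg {G : Type*} (A : Multiset G) (F : G → ℂ)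
    (hF : ∀ h, ∃ a : ℝ, 0 ≤ a ∧ F h = a) : ∃ a : ℝ, 0 ≤ a ∧ multisetAvg A F = a := by
  have key : ∀ B : Multiset G, ∃ a : ℝ, 0 ≤ a ∧ (B.map F).sum = a := by
    intro B
    induction B using Multiset.induction with
    | empty => exact ⟨0, le_rfl, by simp⟩
    | cons b B ih =>
      obtain ⟨a, ha, h1⟩ := ih
      obtain ⟨a', ha', h2⟩ := hF b
      exact ⟨a' + a, add_nonneg ha' ha, by simp [h1, h2]⟩
  obtain ⟨a, ha, h⟩ := key A
  exact ⟨a / Multiset.card A, by positivity, by simp [multisetAvg, h]⟩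

/-- The sumset `A + B = {a + b : a ∈ A, b ∈ B}` of two finite multisets, counted with multiplicity,
so that it has `|A| * |B|` elements (the `+` of Mathlib on multisets is the disjoint union). -/
def multisetSumset {G : Type*} [Add G] (A B : Multiset G) : Multiset G :=
  (A ×ˢ B).map fun p => p.1 + p.2

/-- The tuples `n` of integers with `|n i| ≤ N i` for every `i` (see `mem_integerBox`). -/
def integerBox {r : ℕ} (N : Fin r → ℝ) : Finset (Fin r → ℤ) :=
  Fintype.piFinset fun i => Finset.Icc (-⌊N i⌋) ⌊N i⌋

theorem mem_integerBox {r : ℕ} (N : Fin r → ℝ) (n : Fin r → ℤ) :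
    n ∈ integerBox N ↔ ∀ i, |(n i : ℝ)| ≤ N i := by
  simp only [integerBox, Fintype.mem_piFinset, Finset.mem_Icc]
  refine forall_congr' fun i => ?_
  rw [← abs_le, Int.le_floor, Int.cast_abs]

/-- The data of a (symmetric) coset progression: a finite subgroup `H`, whose elements are all
counted with the same multiplicity `mult`, directions `v i` and real dimensions `N i > 0`. -/
structure CosetProgression (G : Type*) [AddCommGroup G] where
  H : AddSubgroup G
  finite_H : (H : Set G).Finite
  mult : ℕ
  mult_pos : 0 < mult
  rank : ℕ
  v : Fin rank → G
  N : Fin rank → ℝ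
  N_pos : ∀ i, 0 < N i

namespace CosetProgression

variable {G : Type*} [AddCommGroup G]

/-- The multiset `H + {n₁ v₁ + ⋯ + n_r v_r : |n_i| ≤ N_i}`. -/
def toMultiset (Q : CosetProgression G) : Multiset G :=
  multisetSumset (Q.mult • Q.finite_H.toFinset.val)
    ((integerBox Q.N).val.map fun n => ∑ i, n i • Q.v i)

/-- The dilate `ε Q`: same subgroup and directions, dimensions multiplied by `ε`. -/
def dilate (Q : CosetProgression G) (ε : ℝ) (hε : 0 < ε) : CosetProgression G where
  H := Q.H
  finite_H := Q.finite_H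
  mult := Q.mult
  mult_pos := Q.mult_pos
  rank := Q.rank
  v := Q.v
  N := fun i => ε * Q.N i
  N_pos := fun i => mul_pos hε (Q.N_pos i)

end CosetProgression

/-- The measure `μ` is countably generated modulo null sets: up to null sets, all measurable sets
lie in the σ-algebra generated by a countable family of measurable sets. -/
def CountablyGeneratedModNull {X : Type*} [MeasurableSpace X] (μ : Measure X) : Prop :=
  ∃ C : Set (Set X), C.Countable ∧ (∀ s ∈ C, MeasurableSet s) ∧
    ∀ s : Set X, MeasurableSet s →
      ∃ t : Set X, MeasurableSet[MeasurableSpace.generateFrom C] t ∧ s =ᵐ[μ] t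

/-- `(X, μ)` with the action of `G`, where `T^g x = g +ᵥ x`, is a `G`-system: `G` is an at most
countable additive group, `μ` is a probability measure, countably generated modulo null sets, and
every `T^g` is measurable and preserves `μ`. The laws `T^0 = id` and `T^(g+h) = T^g T^h` are
those of `AddAction`. -/
structure IsGSystem (G : Type*) [AddCommGroup G] {X : Type*} [MeasurableSpace X] [AddAction G X]
    (μ : Measure X) : Prop where
  countable : Countable G
  isProbabilityMeasure : IsProbabilityMeasure μ
  countablyGenerated : CountablyGeneratedModNull μ
  measurePreserving : ∀ g : G, MeasurePreserving (fun x : X => g +ᵥ x) μ μ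

section Gowers

variable {G : Type*} [AddCommGroup G] {X : Type*} [AddAction G X]

/-- `T^g f = f ∘ T^(-g)`. -/
def sysTranslate (g : G) (f : X → ℂ) : X → ℂ := fun x => f (-g +ᵥ x)

/-- `Δ_{h,h'} f = (T^h f) * conj (T^h' f)`. -/
def multDeriv (h h' : G) (f : X → ℂ) : X → ℂ :=
  fun x => sysTranslate h f x * (starRingEnd ℂ) (sysTranslate h' f x)

/-- The average over `h₁, …, h_d, h₁', …, h_d' ∈ Q` of `∫ Δ_{h₁,h₁'} ⋯ Δ_{h_d,h_d'} f dμ`. -/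
def gowersAvg [MeasurableSpace X] (μ : Measure X) (Q : Multiset G) : ℕ → (X → ℂ) → ℂ
  | 0, f => ∫ x, f x ∂μ
  | d + 1, f =>
      multisetAvg Q fun h => multisetAvg Q fun h' => gowersAvg μ Q d (multDeriv h h' f)

theorem memLp_multDeriv [MeasurableSpace X] {μ : Measure X} (hμ : IsGSystem G μ) (h h' : G)
    {f : X → ℂ} (hf : MemLp f ⊤ μ) : MemLp (multDeriv h h' f) ⊤ μ := by
  have h1 : MemLp (sysTranslate h f) ⊤ μ := hf.comp_measurePreserving (hμ.measurePreserving (-h))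
  have h2 : MemLp (sysTranslate h' f) ⊤ μ :=
    hf.comp_measurePreserving (hμ.measurePreserving (-h'))
  exact h2.star.mul h1

/-- For bounded measurable `f` and `d ≥ 1`, the average in the definition of the Gowers norm is a
nonnegative real number. -/
theorem gowersAvg_nonneg [MeasurableSpace X] {μ : Measure X} (hμ : IsGSystem G μ)
    (Q : Multiset G) (d : ℕ) (hd : 1 ≤ d) (f : X → ℂ) (hf : MemLp f ⊤ μ) :
    ∃ a : ℝ, 0 ≤ a ∧ gowersAvg μ Q d f = a := by
  have := hμ.isProbabilityMeasure
  induction d, hd using Nat.le_induction generalizing f with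
  | base =>
    have hint : ∀ h h', Integrable (multDeriv h h' f) μ := fun h h' =>
      (memLp_multDeriv hμ h h' hf).integrable le_top
    refine ⟨∫ x, Complex.normSq (multisetAvg Q fun h => sysTranslate h f x) ∂μ,
      integral_nonneg fun x => Complex.normSq_nonneg _, ?_⟩
    rw [← integral_complex_ofReal]
    simp only [gowersAvg]
    have e1 : ∀ h, (multisetAvg Q fun h' => ∫ x, multDeriv h h' f x ∂μ) =
        ∫ x, (multisetAvg Q fun h' => multDeriv h h' f x) ∂μ := fun h =>
      (integral_multisetAvg Q (fun h' => multDeriv h h' f) (hint h)).2.symm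
    simp only [e1]
    rw [← (integral_multisetAvg Q (fun h x => multisetAvg Q fun h' => multDeriv h h' f x)
      (fun h => (integral_multisetAvg Q (fun h' => multDeriv h h' f) (hint h)).1)).2]
    congr 1
    funext x
    rw [← Complex.mul_conj]
    simp only [multisetAvg, multDeriv, Multiset.sum_map_mul_left, map_div₀, map_natCast,
      map_multiset_sum, Multiset.map_map, Function.comp_def, mul_div_assoc,
      Multiset.sum_map_mul_right]
    ring
  | succ d hd ih =>
    exact multisetAvg_nonneg Q _ fun h => multisetAvg_nonneg Q _ fun h' =>
      ih _ (memLp_multDeriv hμ h h' hf)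

/-- The Gowers uniformity seminorm `‖f‖_{U^d_Q(X)}`, for `d ≥ 1` and bounded measurable `f`. The
average whose root is taken is a nonnegative real number (see `gowersAvg_nonneg`). -/
def gowersNorm [MeasurableSpace X] (μ : Measure X) (Q : Multiset G) (d : ℕ) (f : X → ℂ) : ℝ :=
  (gowersAvg μ Q d f).re ^ ((1 : ℝ) / 2 ^ d)

end Gowers

end

/-! The proof is a compactness argument. Suppose that a Bessel inequality for a fixed number `m` of
progressions fails along configurations with `ε → 0`. Limits of L² inner products along an
ultrafilter turn uniformly bounded sequences of functions into a pre-Hilbert space `BF`. A `Factor`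
is a closed translation-invariant star-subalgebra of it, and orthogonal projection to a factor
(`Factor.exists_proj`) replaces conditional expectation, so no limiting measure space is needed. The
dilates of progressions of bounded rank form a `Scale`; group elements that eventually lie in every
dilate are its infinitesimals (`Scale.Inf`).

Each scale has characteristic factors `Z d`. Elements of `Z 0` are invariant under infinitesimals;
an element of `Z (d + 1)` has infinitesimal translates by `s` that are, up to small error, averages
over `j` of `c_{s,j} g_j`, where `g_j` does not depend on `s` and `c_{s,j}` lies in `Z d`. Dual
functions of degree `d + 1` lie in `Z d` (`dual_mem_Z`), and `Z d` is orthogonal to every function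
whose degree `d + 1` Gowers average along infinitesimals tends to zero (`inner_eq_zero_of_mem_Z`).
Concatenation (`mem_Z_sum`) puts `σ.Z a ∩ τ.Z b` inside `(σ.sum τ).Z (a + b)`.

Let `D = d - 1` and let `P_i` be the projection of `f` to the factor `Z D` of the `i`-th scale. The
inner product of `P_i` and `P_j` equals a correlation of `f` with an element of both factors, hence
of `Z (2 * D)` for the sum scale; it vanishes because the degree `2 * D + 1` average of `f` along
`εQ_i + εQ_j` tends to zero. So the `P_i` are orthogonal and their squared norms sum to at most 1.
The Gowers average of `f` along `Q_i` is a correlation with a dual function, hence at most `‖P_i‖`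
in the limit. Thus for fixed `m` and small `ε` the squared averages sum to less than 2
(`exists_sum_norm_sq_le`). A random choice of `m` indices (`exists_selection`) and convexity then
treat families of any size. -/

noncomputable section

universe u v w w'

/-! ### Limits along an ultrafilter -/

/-- The nonprincipal ultrafilter along which all limits are taken. -/
abbrev limitFilter : Filter ℕ := (hyperfilter ℕ : Filter ℕ)

/-- The limit of a bounded sequence along the ultrafilter. -/
def ultralim (x : ℕ → ℂ) : ℂ := limUnder limitFilter x

theorem tendsto_ultralim {x : ℕ → ℂ} {C : ℝ} (h : ∀ n, ‖x n‖ ≤ C) :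
    Tendsto x limitFilter (𝓝 (ultralim x)) := by
  obtain ⟨z, -, hz⟩ := (isCompact_closedBall (0 : ℂ) C).ultrafilter_le_nhds
    ((hyperfilter ℕ).map x) (by
      rw [le_principal_iff]
      rw [Ultrafilter.coe_map, mem_map]
      exact Filter.Eventually.of_forall (fun n => by simpa using h n))
  exact tendsto_nhds_limUnder ⟨z, hz⟩

theorem ultralim_eq {x : ℕ → ℂ} {z : ℂ} (h : Tendsto x limitFilter (𝓝 z)) : ultralim x = z :=
  h.limUnder_eq

/-- A diagonal selection along the ultrafilter. -/
theorem exists_diagonal (A : ℕ → ℕ → Prop) (hA : ∀ k, ∀ᶠ n in limitFilter, A k n) :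
    ∃ κ : ℕ → ℕ, ∀ K, ∀ᶠ n in limitFilter, K ≤ κ n ∧ A (κ n) n := by
  classical
  let P : ℕ → ℕ → Prop := fun n k => k ≤ n ∧ A k n
  refine ⟨fun n => Nat.findGreatest (P n) n, fun K => ?_⟩
  have h1 : ∀ᶠ n in limitFilter, K ≤ n := by
    have : ∀ᶠ n in (cofinite : Filter ℕ), K ≤ n := by
      rw [Nat.cofinite_eq_atTop]; exact eventually_ge_atTop K
    exact hyperfilter_le_cofinite this
  filter_upwards [h1, hA K] with n hn hAn
  exact ⟨Nat.le_findGreatest hn ⟨hn, hAn⟩, (Nat.findGreatest_spec (P := P n) hn ⟨hn, hAn⟩).2⟩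

/-! ### Finite averages -/

section Averages

theorem norm_expect_le_of_le {ι E : Type*} [Fintype ι] [Nonempty ι] [NormedAddCommGroup E]
    [NormedSpace ℝ E] [Module ℚ≥0 E] {f : ι → E} {C : ℝ} (h : ∀ i, ‖f i‖ ≤ C) : ‖𝔼 i, f i‖ ≤ C := by
  have h1 : (Fintype.card ι : ℝ) • (𝔼 i, f i) = ∑ i, f i := by
    rw [Nat.cast_smul_eq_nsmul, Fintype.card_smul_expect]
  have hpos : (0 : ℝ) < Fintype.card ι := by exact_mod_cast Fintype.card_pos
  have h2 : ‖(Fintype.card ι : ℝ) • (𝔼 i, f i)‖ ≤ Fintype.card ι * C := by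
    rw [h1]
    calc ‖∑ i, f i‖ ≤ ∑ i, ‖f i‖ := norm_sum_le _ _
      _ ≤ ∑ _i : ι, C := Finset.sum_le_sum fun i _ => h i
      _ = _ := by simp
  rw [norm_smul, Real.norm_of_nonneg hpos.le] at h2
  exact le_of_mul_le_mul_left h2 hpos

/-- Choosing such an index at every stage replaces an average of families by a single sequence of
members, to which hypotheses about arbitrary sequences of indices apply. -/
theorem exists_norm_expect_le {ι : Type*} [Fintype ι] [Nonempty ι] (f : ι → ℂ) :
    ∃ i, ‖𝔼 i, f i‖ ≤ ‖f i‖ := by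
  obtain ⟨i, hi⟩ := Finite.exists_max fun i => ‖f i‖
  exact ⟨i, norm_expect_le_of_le hi⟩

theorem exists_expect_le_real {ι : Type*} [Fintype ι] [Nonempty ι] (f : ι → ℝ) :
    ∃ i, 𝔼 i, f i ≤ f i := by
  obtain ⟨i, -, hi⟩ := Finset.exists_le_of_le_expect (s := Finset.univ) (f := f)
    Finset.univ_nonempty le_rfl
  exact ⟨i, hi⟩

theorem integral_expect {ι X : Type*} [Fintype ι] [MeasurableSpace X] {μ : Measure X}
    {f : ι → X → ℂ} (hf : ∀ i, Integrable (f i) μ) :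
    ∫ x, 𝔼 i, f i x ∂μ = 𝔼 i, ∫ x, f i x ∂μ := by
  simp only [Fintype.expect_eq_sum_div_card]
  rw [integral_div, integral_finsetSum _ fun i _ => hf i]

theorem measurable_expect {ι X : Type*} [Fintype ι] [MeasurableSpace X]
    {f : ι → X → ℂ} (hf : ∀ i, Measurable (f i)) : Measurable fun x => 𝔼 i, f i x := by
  simp only [Fintype.expect_eq_sum_div_card]
  exact (Finset.measurable_sum _ fun i _ => hf i).div_const _

theorem star_expect {ι : Type*} [Fintype ι] (f : ι → ℂ) :
    (starRingEnd ℂ) (𝔼 i, f i) = 𝔼 i, (starRingEnd ℂ) (f i) := by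
  simp [Fintype.expect_eq_sum_div_card, map_div₀, map_sum]

/-- If `q` is small whenever `v` is small, and `v` is small on average, so is `q`. -/
theorem tendsto_expect_of_tendsto {A : ℕ → Type w} [∀ n, Fintype (A n)] [∀ n, Nonempty (A n)]
    (v q : ∀ n, A n → ℝ) (C : ℝ) (hv : ∀ n a, 0 ≤ v n a) (hq : ∀ n a, 0 ≤ q n a)
    (hqC : ∀ n a, q n a ≤ C)
    (h : ∀ a : ∀ n, A n, Tendsto (fun n => v n (a n)) limitFilter (𝓝 0) →
      Tendsto (fun n => q n (a n)) limitFilter (𝓝 0))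
    (hlim : Tendsto (fun n => 𝔼 a, v n a) limitFilter (𝓝 0)) :
    Tendsto (fun n => 𝔼 a, q n a) limitFilter (𝓝 0) := by
  set e : ℕ → ℝ := fun n => 𝔼 a, v n a
  have he : ∀ n, 0 ≤ e n := fun n => Finset.expect_nonneg fun a _ => hv n a
  have hs : Tendsto (fun n => √(e n)) limitFilter (𝓝 0) := by
    simpa using hlim.sqrt
  have key : ∀ n, ∃ a, 𝔼 a, q n a ≤ q n a + √(e n) ∧ v n a ≤ √(e n) * (C + √(e n)) := by
    intro n
    -- With the penalty `v / √e`, whose mean is `√e`, one index serves both purposes: `q` there is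
    -- at least its mean up to `√e`, and `v` is at most `√e * (C + √e)`.
    obtain ⟨a, ha⟩ := exists_expect_le_real fun a => q n a - v n a / √(e n)
    rw [Finset.expect_sub_distrib, ← Finset.expect_div] at ha
    change _ - e n / _ ≤ _ at ha
    rw [Real.div_sqrt] at ha
    have hva : 0 ≤ v n a / √(e n) := div_nonneg (hv n a) (Real.sqrt_nonneg _)
    refine ⟨a, by linarith, ?_⟩
    have hE : 0 ≤ 𝔼 a, q n a := Finset.expect_nonneg fun a _ => hq n a
    rcases (he n).eq_or_lt with h0 | h0
    · have : v n a = 0 := by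
        have h1 : ∑ a, v n a = 0 := by
          have : e n = 0 := h0.symm
          simp only [e, Fintype.expect_eq_sum_div_card, div_eq_zero_iff] at this
          rcases this with h | h
          · exact h
          · simp at h
        exact (Finset.sum_eq_zero_iff_of_nonneg fun a _ => hv n a).1 h1 a (Finset.mem_univ _)
      rw [this]
      have : 0 ≤ C := (hq n a).trans (hqC n a)
      positivity
    · have hs0 : 0 < √(e n) := Real.sqrt_pos.2 h0
      have h2 : v n a / √(e n) ≤ C + √(e n) := by
        have := hqC n a
        linarith
      rw [div_le_iff₀ hs0] at h2
      linarith
  choose a ha1 ha2 using key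
  have hva : Tendsto (fun n => v n (a n)) limitFilter (𝓝 0) := by
    refine squeeze_zero (fun n => hv n _) ha2 ?_
    simpa using hs.mul (hs.const_add C)
  refine squeeze_zero (fun n => Finset.expect_nonneg fun a _ => hq n a) ha1 ?_
  simpa using (h a hva).add hs

end Averages

/-! ### Sequences of systems and the limiting pre-Hilbert space -/

set_option linter.checkUnivs false in
/-- A sequence of systems. -/
structure SysSeq where
  G : ℕ → Type u
  X : ℕ → Type v
  [instG : ∀ n, AddCommGroup (G n)]
  [instM : ∀ n, MeasurableSpace (X n)]
  [instA : ∀ n, AddAction (G n) (X n)]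
  μ : ∀ n, Measure (X n)
  sys : ∀ n, IsGSystem (G n) (μ n)

attribute [instance] SysSeq.instG SysSeq.instM SysSeq.instA

namespace SysSeq

variable (S : SysSeq.{u, v})

instance (n : ℕ) : IsProbabilityMeasure (S.μ n) := (S.sys n).isProbabilityMeasure

/-- Uniformly bounded sequences of measurable functions. -/
def bddSubalgebra : StarSubalgebra ℂ (∀ n, S.X n → ℂ) where
  carrier := {F | (∀ n, Measurable (F n)) ∧ ∃ C : ℝ, ∀ n x, ‖F n x‖ ≤ C}
  mul_mem' := by
    rintro F H ⟨hF, C, hC⟩ ⟨hH, D, hD⟩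
    refine ⟨fun n => (hF n).mul (hH n), C * D, fun n x => ?_⟩
    simp only [Pi.mul_apply, norm_mul]
    exact mul_le_mul (hC n x) (hD n x) (norm_nonneg _) ((norm_nonneg _).trans (hC n x))
  add_mem' := by
    rintro F H ⟨hF, C, hC⟩ ⟨hH, D, hD⟩
    exact ⟨fun n => (hF n).add (hH n), C + D, fun n x =>
      (norm_add_le _ _).trans (add_le_add (hC n x) (hD n x))⟩
  algebraMap_mem' := fun z => ⟨fun n => measurable_const, ‖z‖, fun n x => le_rfl⟩
  star_mem' := by
    rintro F ⟨hF, C, hC⟩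
    exact ⟨fun n => Complex.continuous_conj.measurable.comp (hF n), C, fun n x => by
      simpa using hC n x⟩

/-- The algebra of uniformly bounded sequences of measurable functions. -/
def BF : Type v := S.bddSubalgebra

instance : CommRing S.BF := inferInstanceAs (CommRing S.bddSubalgebra)
instance : Algebra ℂ S.BF := inferInstanceAs (Algebra ℂ S.bddSubalgebra)
instance : StarRing S.BF := inferInstanceAs (StarRing S.bddSubalgebra)
instance : StarModule ℂ S.BF := inferInstanceAs (StarModule ℂ S.bddSubalgebra)

variable {S}

namespace BF

/-- The underlying sequence of functions. -/
def fn (F : S.BF) (n : ℕ) (x : S.X n) : ℂ := F.1 n x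

theorem measurable (F : S.BF) (n : ℕ) : Measurable (F.fn n) := F.2.1 n

theorem exists_bound (F : S.BF) : ∃ C : ℝ, 0 < C ∧ ∀ n x, ‖F.fn n x‖ ≤ C := by
  obtain ⟨C, hC⟩ := F.2.2
  exact ⟨max C 1, by positivity, fun n x => (hC n x).trans (le_max_left _ _)⟩

/-- The constructor from a uniformly bounded sequence. -/
def mk (F : ∀ n, S.X n → ℂ) (hF : ∀ n, Measurable (F n)) (C : ℝ) (hC : ∀ n x, ‖F n x‖ ≤ C) :
    S.BF := ⟨F, hF, C, hC⟩

@[simp] theorem mk_fn (F : ∀ n, S.X n → ℂ) (hF) (C : ℝ) (hC) (n : ℕ) (x : S.X n) :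
    (mk F hF C hC).fn n x = F n x := rfl

@[ext] theorem ext {F H : S.BF} (h : ∀ n x, F.fn n x = H.fn n x) : F = H :=
  Subtype.ext (funext fun n => funext fun x => h n x)

@[simp] theorem add_fn (F H : S.BF) (n x) : (F + H).fn n x = F.fn n x + H.fn n x := rfl
@[simp] theorem sub_fn (F H : S.BF) (n x) : (F - H).fn n x = F.fn n x - H.fn n x := rfl
@[simp] theorem mul_fn (F H : S.BF) (n x) : (F * H).fn n x = F.fn n x * H.fn n x := rfl
@[simp] theorem smul_fn (z : ℂ) (F : S.BF) (n x) : (z • F).fn n x = z * F.fn n x := rfl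
@[simp] theorem star_fn (F : S.BF) (n x) : (star F).fn n x = (starRingEnd ℂ) (F.fn n x) := rfl
@[simp] theorem one_fn (n x) : (1 : S.BF).fn n x = 1 := rfl
@[simp] theorem zero_fn (n x) : (0 : S.BF).fn n x = 0 := rfl
@[simp] theorem algebraMap_fn (z : ℂ) (n x) : (algebraMap ℂ S.BF z).fn n x = z := rfl

theorem integrable (F : S.BF) (n : ℕ) : Integrable (F.fn n) (S.μ n) := by
  obtain ⟨C, -, hC⟩ := F.exists_bound
  exact Integrable.of_bound (F.measurable n).aestronglyMeasurable C
    (Filter.Eventually.of_forall (hC n))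

theorem norm_integral_le (F : S.BF) {n : ℕ} {C : ℝ} (hC : ∀ x, ‖F.fn n x‖ ≤ C) :
    ‖∫ x, F.fn n x ∂S.μ n‖ ≤ C := by
  simpa using norm_integral_le_of_norm_le_const (μ := S.μ n) (Filter.Eventually.of_forall hC)

/-- The limit of the integrals. -/
def mean (F : S.BF) : ℂ := ultralim fun n => ∫ x, F.fn n x ∂S.μ n

theorem tendsto_mean (F : S.BF) :
    Tendsto (fun n => ∫ x, F.fn n x ∂S.μ n) limitFilter (𝓝 F.mean) := by
  obtain ⟨C, -, hC⟩ := F.exists_bound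
  exact tendsto_ultralim fun n => F.norm_integral_le (hC n)

theorem mean_eq {F : S.BF} {z : ℂ}
    (h : Tendsto (fun n => ∫ x, F.fn n x ∂S.μ n) limitFilter (𝓝 z)) : F.mean = z :=
  ultralim_eq h

theorem mean_add (F H : S.BF) : (F + H).mean = F.mean + H.mean := by
  refine mean_eq ((F.tendsto_mean.add H.tendsto_mean).congr fun n => ?_)
  exact (integral_add (F.integrable n) (H.integrable n)).symm

theorem mean_smul (z : ℂ) (F : S.BF) : (z • F).mean = z * F.mean := by
  refine mean_eq ((F.tendsto_mean.const_mul z).congr fun n => ?_)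
  exact (integral_const_mul z _).symm

theorem mean_star (F : S.BF) : (star F).mean = (starRingEnd ℂ) F.mean := by
  refine mean_eq (((Complex.continuous_conj.tendsto _).comp F.tendsto_mean).congr fun n => ?_)
  exact integral_conj.symm

theorem integral_star_mul_self (F : S.BF) (n : ℕ) :
    ∫ x, (star F * F).fn n x ∂S.μ n = ((∫ x, ‖F.fn n x‖ ^ 2 ∂S.μ n : ℝ) : ℂ) := by
  rw [← integral_complex_ofReal]
  refine integral_congr_ae (Filter.Eventually.of_forall fun x => ?_)
  simp [← Complex.normSq_eq_conj_mul_self, Complex.normSq_eq_norm_sq]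

instance : PreInnerProductSpace.Core ℂ S.BF where
  inner F H := (star F * H).mean
  conj_inner_symm F H := by rw [← mean_star, star_mul, star_star]
  re_inner_nonneg F := by
    have h := (Complex.continuous_re.tendsto _).comp (star F * F).tendsto_mean
    refine ge_of_tendsto' h fun n => ?_
    simp only [Function.comp_apply]
    rw [integral_star_mul_self, Complex.ofReal_re]
    positivity
  add_left F H K := by rw [← mean_add, star_add, add_mul]
  smul_left F H z := by rw [star_smul, smul_mul_assoc, mean_smul]; rfl

instance : SeminormedAddCommGroup S.BF :=
  InnerProductSpace.Core.toSeminormedAddCommGroup (𝕜 := ℂ)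

instance : InnerProductSpace ℂ S.BF := InnerProductSpace.ofCore _

theorem inner_def (F H : S.BF) : inner ℂ F H = (star F * H).mean := rfl

theorem tendsto_inner (F H : S.BF) :
    Tendsto (fun n => ∫ x, (starRingEnd ℂ) (F.fn n x) * H.fn n x ∂S.μ n) limitFilter
      (𝓝 (inner ℂ F H)) := (star F * H).tendsto_mean

theorem tendsto_norm_sq (F : S.BF) :
    Tendsto (fun n => ∫ x, ‖F.fn n x‖ ^ 2 ∂S.μ n) limitFilter (𝓝 (‖F‖ ^ 2)) := by
  have h := (Complex.continuous_re.tendsto _).comp (star F * F).tendsto_mean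
  rw [← inner_def] at h
  have h2 : (inner ℂ F F : ℂ).re = ‖F‖ ^ 2 := by
    rw [inner_self_eq_norm_sq_to_K]; norm_cast
  rw [h2] at h
  refine h.congr fun n => ?_
  simp only [Function.comp_apply]
  rw [integral_star_mul_self, Complex.ofReal_re]

theorem integrable_norm_sq (F : S.BF) (n : ℕ) :
    Integrable (fun x => ‖F.fn n x‖ ^ 2) (S.μ n) := by
  obtain ⟨C, -, hC⟩ := F.exists_bound
  refine Integrable.of_bound ((F.measurable n).norm.pow_const 2).aestronglyMeasurable (C ^ 2)
    (Filter.Eventually.of_forall fun x => ?_)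
  rw [norm_pow, norm_norm]
  exact pow_le_pow_left₀ (norm_nonneg _) (hC n x) 2

/-- Comparison of limit norms from an eventual pointwise bound. -/
theorem norm_le_of_pointwise {F H : S.BF} {C : ℝ} (hC : 0 ≤ C)
    (h : ∀ᶠ n in limitFilter, ∀ x, ‖F.fn n x‖ ≤ C * ‖H.fn n x‖) : ‖F‖ ≤ C * ‖H‖ := by
  have h1 : ‖F‖ ^ 2 ≤ C ^ 2 * ‖H‖ ^ 2 := by
    refine le_of_tendsto_of_tendsto F.tendsto_norm_sq (H.tendsto_norm_sq.const_mul (C ^ 2)) ?_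
    filter_upwards [h] with n hn
    rw [← integral_const_mul]
    refine integral_mono (F.integrable_norm_sq n) ((H.integrable_norm_sq n).const_mul _) fun x => ?_
    simp only
    rw [← mul_pow]
    exact pow_le_pow_left₀ (norm_nonneg _) (hn x) 2
  rw [← mul_pow] at h1
  exact le_of_sq_le_sq h1 (by positivity)

theorem norm_one : ‖(1 : S.BF)‖ = 1 := by
  have h : ‖(1 : S.BF)‖ ^ 2 = 1 := by
    refine tendsto_nhds_unique (1 : S.BF).tendsto_norm_sq ?_
    simp
  nlinarith [norm_nonneg (1 : S.BF)]

theorem norm_le_of_bound {F : S.BF} {C : ℝ} (hC : 0 ≤ C)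
    (h : ∀ᶠ n in limitFilter, ∀ x, ‖F.fn n x‖ ≤ C) : ‖F‖ ≤ C := by
  simpa [norm_one] using norm_le_of_pointwise (F := F) (H := 1) hC (by simpa using h)

theorem norm_mul_le_of_bound {F H : S.BF} {C : ℝ} (hC : 0 ≤ C)
    (h : ∀ᶠ n in limitFilter, ∀ x, ‖F.fn n x‖ ≤ C) : ‖F * H‖ ≤ C * ‖H‖ := by
  refine norm_le_of_pointwise hC ?_
  filter_upwards [h] with n hn x
  rw [mul_fn, norm_mul]
  exact mul_le_mul_of_nonneg_right (hn x) (norm_nonneg _)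

theorem norm_star (F : S.BF) : ‖star F‖ = ‖F‖ := by
  refine le_antisymm ?_ ?_
  · simpa using norm_le_of_pointwise (F := star F) (H := F) zero_le_one (by simp)
  · simpa using norm_le_of_pointwise (F := F) (H := star F) zero_le_one (by simp)

theorem norm_sub_eq_zero {F H : S.BF} (h : ∀ᶠ n in limitFilter, ∀ x, F.fn n x = H.fn n x) :
    ‖F - H‖ = 0 := by
  refine le_antisymm (norm_le_of_bound le_rfl ?_) (norm_nonneg _)
  filter_upwards [h] with n hn x
  simp [hn x]

/-- Translation by a sequence of group elements. -/
def tr (t : ∀ n, S.G n) (F : S.BF) : S.BF :=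
  mk (fun n => sysTranslate (t n) (F.fn n))
    (fun n => (F.measurable n).comp ((S.sys n).measurePreserving _).measurable)
    F.exists_bound.choose fun n _ => F.exists_bound.choose_spec.2 n _

theorem tr_fn (t : ∀ n, S.G n) (F : S.BF) (n x) : (tr t F).fn n x = F.fn n (-(t n) +ᵥ x) := rfl

theorem tr_add (t : ∀ n, S.G n) (F H : S.BF) : tr t (F + H) = tr t F + tr t H := rfl
theorem tr_sub (t : ∀ n, S.G n) (F H : S.BF) : tr t (F - H) = tr t F - tr t H := rfl
theorem tr_mul (t : ∀ n, S.G n) (F H : S.BF) : tr t (F * H) = tr t F * tr t H := rfl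
theorem tr_star (t : ∀ n, S.G n) (F : S.BF) : tr t (star F) = star (tr t F) := rfl
theorem tr_algebraMap (t : ∀ n, S.G n) (z : ℂ) :
    tr t (algebraMap ℂ S.BF z) = algebraMap ℂ S.BF z := rfl

theorem tr_tr (s t : ∀ n, S.G n) (F : S.BF) : tr s (tr t F) = tr (s + t) F := by
  ext n x
  simp only [tr_fn, Pi.add_apply, vadd_vadd]
  congr 2
  abel

theorem mean_tr (t : ∀ n, S.G n) (F : S.BF) : (tr t F).mean = F.mean := by
  refine mean_eq (F.tendsto_mean.congr fun n => ?_)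
  have := ((S.sys n).measurePreserving (-(t n)))
  have h2 := integral_map (μ := S.μ n) this.measurable.aemeasurable
    (f := F.fn n) (F.measurable n).aestronglyMeasurable
  rw [this.map_eq] at h2
  exact h2

theorem inner_tr (t : ∀ n, S.G n) (F H : S.BF) : inner ℂ (tr t F) (tr t H) = inner ℂ F H := by
  rw [inner_def, inner_def, ← tr_star, ← tr_mul, mean_tr]

theorem norm_tr (t : ∀ n, S.G n) (F : S.BF) : ‖tr t F‖ = ‖F‖ := by
  rw [@norm_eq_sqrt_re_inner ℂ, @norm_eq_sqrt_re_inner ℂ, inner_tr]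

theorem inner_eq_zero_of_norm_left {F : S.BF} (hF : ‖F‖ = 0) (H : S.BF) : inner ℂ F H = 0 := by
  have := norm_inner_le_norm (𝕜 := ℂ) F H
  rw [hF, zero_mul] at this
  exact norm_le_zero_iff.1 this

theorem inner_eq_zero_of_norm_right {H : S.BF} (hH : ‖H‖ = 0) (F : S.BF) : inner ℂ F H = 0 := by
  have := norm_inner_le_norm (𝕜 := ℂ) F H
  rw [hH, mul_zero] at this
  exact norm_le_zero_iff.1 this

end BF

end SysSeq

/-! ### Factors and orthogonal projection -/

namespace SysSeq

/-- A closed translation-invariant unital star-subalgebra of the algebra of bounded sequences, the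
analogue of a factor of the limiting system. -/
structure Factor (S : SysSeq.{u, v}) where
  carrier : Set S.BF
  algebraMap_mem' : ∀ z : ℂ, algebraMap ℂ S.BF z ∈ carrier
  add_mem' : ∀ {F H : S.BF}, F ∈ carrier → H ∈ carrier → F + H ∈ carrier
  mul_mem' : ∀ {F H : S.BF}, F ∈ carrier → H ∈ carrier → F * H ∈ carrier
  star_mem' : ∀ {F : S.BF}, F ∈ carrier → star F ∈ carrier
  closed' : ∀ F : S.BF, (∀ κ > 0, ∃ P ∈ carrier, ‖F - P‖ ≤ κ) → F ∈ carrier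
  tr_mem' : ∀ (t : ∀ n, S.G n) {F : S.BF}, F ∈ carrier → F.tr t ∈ carrier

variable {S : SysSeq.{u, v}}

namespace Factor

instance : Membership S.BF S.Factor := ⟨fun B F => F ∈ B.carrier⟩

variable (B : S.Factor)

theorem algebraMap_mem (z : ℂ) : algebraMap ℂ S.BF z ∈ B := B.algebraMap_mem' z

theorem one_mem : (1 : S.BF) ∈ B := by simpa using B.algebraMap_mem 1

theorem zero_mem : (0 : S.BF) ∈ B := by simpa using B.algebraMap_mem 0

variable {B}

theorem add_mem {F H : S.BF} (hF : F ∈ B) (hH : H ∈ B) : F + H ∈ B := B.add_mem' hF hH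

theorem mul_mem {F H : S.BF} (hF : F ∈ B) (hH : H ∈ B) : F * H ∈ B := B.mul_mem' hF hH

theorem star_mem {F : S.BF} (hF : F ∈ B) : star F ∈ B := B.star_mem' hF

theorem tr_mem (t : ∀ n, S.G n) {F : S.BF} (hF : F ∈ B) : F.tr t ∈ B := B.tr_mem' t hF

theorem mem_of_approx {F : S.BF} (h : ∀ κ > 0, ∃ P ∈ B, ‖F - P‖ ≤ κ) : F ∈ B := B.closed' F h

theorem mem_of_norm_sub {F P : S.BF} (hP : P ∈ B) (h : ‖F - P‖ = 0) : F ∈ B :=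
  mem_of_approx fun _ hκ => ⟨P, hP, h.trans_le hκ.le⟩

theorem smul_mem (z : ℂ) {F : S.BF} (hF : F ∈ B) : z • F ∈ B := by
  rw [Algebra.smul_def]
  exact mul_mem (B.algebraMap_mem z) hF

theorem sub_mem {F H : S.BF} (hF : F ∈ B) (hH : H ∈ B) : F - H ∈ B := by
  have : F - H = F + (-1 : ℂ) • H := by simp [sub_eq_add_neg]
  rw [this]
  exact add_mem hF (smul_mem _ hH)

/-- A sequence each of whose terms comes from one of two members is a member. -/
theorem mem_of_forall_or {F H K : S.BF} (hF : F ∈ B) (hH : H ∈ B)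
    (h : ∀ n, (∀ x, K.fn n x = F.fn n x) ∨ (∀ x, K.fn n x = H.fn n x)) : K ∈ B := by
  -- One of the two alternatives holds on a set of the ultrafilter, and the other stages do not
  -- affect the limit seminorm.
  rcases Ultrafilter.eventually_or.1
    (Filter.Eventually.of_forall h : ∀ᶠ n in (hyperfilter ℕ : Filter ℕ), _) with h1 | h1
  · exact mem_of_norm_sub hF (BF.norm_sub_eq_zero h1)
  · exact mem_of_norm_sub hH (BF.norm_sub_eq_zero h1)

variable (S) in
/-- The factor of all bounded sequences. -/
def top : S.Factor where
  carrier := Set.univ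
  algebraMap_mem' _ := trivial
  add_mem' _ _ := trivial
  mul_mem' _ _ := trivial
  star_mem' _ := trivial
  closed' _ _ := trivial
  tr_mem' _ _ _ := trivial

theorem mem_top (F : S.BF) : F ∈ top S := trivial

/-- The intersection of two factors. -/
def inf (B C : S.Factor) : S.Factor where
  carrier := {F | F ∈ B ∧ F ∈ C}
  algebraMap_mem' z := ⟨B.algebraMap_mem z, C.algebraMap_mem z⟩
  add_mem' hF hH := ⟨add_mem hF.1 hH.1, add_mem hF.2 hH.2⟩
  mul_mem' hF hH := ⟨mul_mem hF.1 hH.1, mul_mem hF.2 hH.2⟩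
  star_mem' hF := ⟨star_mem hF.1, star_mem hF.2⟩
  closed' F h := by
    refine ⟨mem_of_approx fun κ hκ => ?_, mem_of_approx fun κ hκ => ?_⟩
    · obtain ⟨P, hP, h⟩ := h κ hκ
      exact ⟨P, hP.1, h⟩
    · obtain ⟨P, hP, h⟩ := h κ hκ
      exact ⟨P, hP.2, h⟩
  tr_mem' t _ hF := ⟨tr_mem t hF.1, tr_mem t hF.2⟩

/-- Continuous functional calculus on a disc containing the values. -/
def compOn {C : ℝ} (F : S.BF) (hF : ∀ n x, ‖F.fn n x‖ ≤ C)
    (g : C(Metric.closedBall (0 : ℂ) C, ℂ)) : S.BF :=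
  BF.mk (fun n x => g ⟨F.fn n x, mem_closedBall_zero_iff.2 (hF n x)⟩)
    (fun n => g.continuous.measurable.comp ((F.measurable n).subtype_mk))
    ‖g‖ fun _ _ => g.norm_coe_le_norm _

/-- Stone–Weierstrass on the disc: polynomials in `z` and its conjugate are dense, and uniform
approximation passes to the limit seminorm, for which factors are closed. -/
theorem compOn_mem {C : ℝ} {F : S.BF} (hFB : F ∈ B) (hF : ∀ n x, ‖F.fn n x‖ ≤ C)
    (g : C(Metric.closedBall (0 : ℂ) C, ℂ)) : compOn F hF g ∈ B := by
  induction g using ContinuousMap.induction_on_of_compact with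
  | const r => exact B.algebraMap_mem r
  | id => exact hFB
  | star_id => exact star_mem hFB
  | add f g hf hg => exact add_mem hf hg
  | mul f g hf hg => exact mul_mem hf hg
  | frequently f h =>
    refine mem_of_approx fun κ hκ => ?_
    obtain ⟨g, hg, hgf⟩ := (h.and_eventually (Metric.ball_mem_nhds f hκ)).exists
    refine ⟨_, hg, BF.norm_le_of_bound hκ.le (Filter.Eventually.of_forall fun n x => ?_)⟩
    have h1 := (f - g).norm_coe_le_norm ⟨F.fn n x, mem_closedBall_zero_iff.2 (hF n x)⟩
    refine h1.trans ?_
    rw [← dist_eq_norm, dist_comm]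
    exact hgf.le

/-- Radial retraction to the disc does not increase the distance to points of the disc. Outside the
disc, expanding both squares and applying Cauchy–Schwarz leaves a difference of at least `(‖z‖ - C)
^ 2`. -/
theorem norm_sub_clamp_le {C : ℝ} (hC : 0 < C) {w z : ℂ} (hw : ‖w‖ ≤ C) :
    ‖w - ((C / max C ‖z‖ : ℝ) : ℂ) * z‖ ≤ ‖w - z‖ := by
  rcases le_total ‖z‖ C with h | h
  · rw [max_eq_left h, div_self hC.ne']; simp
  · rw [max_eq_right h]
    set r := ‖z‖
    have hr : 0 < r := hC.trans_le h
    have e1 : ∀ a : ℝ, ‖w - (a : ℂ) * z‖ ^ 2 = ‖w‖ ^ 2 - 2 * a * inner ℝ w z + a ^ 2 * r ^ 2 := by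
      intro a
      have h2 : (a : ℂ) * z = a • z := (Complex.real_smul).symm
      rw [h2, norm_sub_sq_real, inner_smul_right, norm_smul, mul_pow, Real.norm_eq_abs, sq_abs]
      ring
    have hx : inner ℝ w z ≤ C * r :=
      (real_inner_le_norm w z).trans (mul_le_mul_of_nonneg_right hw hr.le)
    have e2 := e1 1
    simp only [Complex.ofReal_one, one_mul, mul_one, one_pow] at e2
    have e3 := e1 (C / r)
    refine le_of_sq_le_sq ?_ (norm_nonneg _)
    rw [e2, e3]
    have h3 : (C / r) ^ 2 * r ^ 2 = C ^ 2 := by field_simp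
    rw [h3]
    have h4 : C / r ≤ 1 := (div_le_one hr).2 h
    have h5 : (1 - C / r) * inner ℝ w z ≤ (1 - C / r) * (C * r) :=
      mul_le_mul_of_nonneg_left hx (by linarith)
    have h6 : (1 - C / r) * (C * r) = C * r - C ^ 2 := by field_simp
    nlinarith [sq_nonneg (r - C)]

/-- A member can be replaced by a member bounded by `C`, at least as close to any given sequence
bounded by `C`. -/
theorem exists_clamp {P F : S.BF} (hP : P ∈ B) {C : ℝ} (hC : 0 < C)
    (hF : ∀ n x, ‖F.fn n x‖ ≤ C) :
    ∃ Q ∈ B, (∀ n x, ‖Q.fn n x‖ ≤ C) ∧ ‖F - Q‖ ≤ ‖F - P‖ := by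
  obtain ⟨D, -, hD⟩ := P.exists_bound
  have hcont : Continuous fun z : ℂ => ((C / max C ‖z‖ : ℝ) : ℂ) * z := by
    refine (Complex.continuous_ofReal.comp (continuous_const.div (by fun_prop) fun z => ?_)).mul
      continuous_id
    exact (hC.trans_le (le_max_left _ _)).ne'
  refine ⟨_, compOn_mem hP hD ⟨fun z => ((C / max C ‖(z : ℂ)‖ : ℝ) : ℂ) * z,
    hcont.comp continuous_subtype_val⟩, fun n x => ?_, ?_⟩
  · change ‖((C / max C ‖P.fn n x‖ : ℝ) : ℂ) * P.fn n x‖ ≤ C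
    have h0 : 0 < max C ‖P.fn n x‖ := hC.trans_le (le_max_left _ _)
    rw [norm_mul, Complex.norm_real, Real.norm_of_nonneg (by positivity), div_mul_eq_mul_div,
      div_le_iff₀ h0]
    exact mul_le_mul_of_nonneg_left (le_max_right _ _) hC.le
  · have := BF.norm_le_of_pointwise (F := F - compOn P hD ⟨fun z => ((C / max C ‖(z : ℂ)‖ : ℝ) : ℂ) * z,
      hcont.comp continuous_subtype_val⟩) (H := F - P) zero_le_one
      (Filter.Eventually.of_forall fun n x => by
        rw [one_mul]
        exact norm_sub_clamp_le hC (hF n x))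
    simpa using this

/-- First variation at a minimal distance: a small step `t` in the direction of the inner product
would otherwise shorten `R`. The step length `1 / (‖H‖ ^ 2 + 1)` also covers seminorm zero. -/
theorem inner_eq_zero_of_norm_le {R H : S.BF} (h : ∀ t : ℂ, ‖R‖ ≤ ‖R - t • H‖) :
    inner ℂ H R = 0 := by
  by_contra hne
  set c : ℂ := inner ℂ H R
  have hc : 0 < ‖c‖ ^ 2 := by positivity
  set s : ℝ := 1 / (‖H‖ ^ 2 + 1)
  have hs : 0 < s := by positivity
  have h1 := pow_le_pow_left₀ (norm_nonneg _) (h ((s : ℂ) * c)) 2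
  rw [@norm_sub_sq ℂ, inner_smul_right, ← inner_conj_symm R H] at h1
  have h2 : RCLike.re ((s : ℂ) * c * (starRingEnd ℂ) c) = s * ‖c‖ ^ 2 := by
    rw [mul_assoc, Complex.mul_conj, Complex.normSq_eq_norm_sq]
    norm_cast
  change _ ≤ _ - 2 * RCLike.re ((s : ℂ) * c * (starRingEnd ℂ) c) + _ at h1
  rw [h2, norm_smul, norm_mul, Complex.norm_real, Real.norm_of_nonneg hs.le] at h1
  have h3 : s * (‖H‖ ^ 2 + 1) = 1 := by simp only [s]; field_simp
  have h4 : 2 * (s * ‖c‖ ^ 2) ≤ (s * ‖c‖ ^ 2) * (s * ‖H‖ ^ 2) := by nlinarith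
  have h5 : s * ‖H‖ ^ 2 ≤ 1 := by nlinarith
  have h6 : 0 < s * ‖c‖ ^ 2 := by positivity
  nlinarith

variable (B) in
/-- Orthogonal projection to a factor. -/
theorem exists_proj (F : S.BF) : ∃ P ∈ B, ∀ H ∈ B, inner ℂ H (F - P) = 0 := by
  obtain ⟨C, hC, hF⟩ := F.exists_bound
  set E : Set ℝ := {e | ∃ p ∈ B, e = ‖F - p‖}
  have hEne : E.Nonempty := ⟨_, 0, B.zero_mem, rfl⟩
  have hEbdd : BddBelow E := ⟨0, by rintro e ⟨p, -, rfl⟩; exact norm_nonneg _⟩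
  set e := sInf E
  have he : ∀ p ∈ B, e ≤ ‖F - p‖ := fun p hp => csInf_le hEbdd ⟨p, hp, rfl⟩
  have he0 : 0 ≤ e := le_csInf hEne (by rintro e ⟨p, -, rfl⟩; exact norm_nonneg _)
  have hex : ∀ i : ℕ, ∃ p ∈ B, (∀ n x, ‖p.fn n x‖ ≤ C) ∧ ‖F - p‖ ^ 2 ≤ e ^ 2 + (1 / 2) ^ i := by
    intro i
    have hlt : e < √(e ^ 2 + (1 / 2) ^ i) := by
      apply Real.lt_sqrt_of_sq_lt
      have : (0 : ℝ) < (1 / 2) ^ i := by positivity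
      linarith
    obtain ⟨_, ⟨p, hp, rfl⟩, hlt'⟩ := exists_lt_of_csInf_lt hEne hlt
    obtain ⟨q, hq, hqC, hqF⟩ := exists_clamp hp hC hF
    refine ⟨q, hq, hqC, ?_⟩
    rw [← Real.sq_sqrt (by positivity : (0 : ℝ) ≤ e ^ 2 + (1 / 2) ^ i)]
    exact pow_le_pow_left₀ (norm_nonneg _) (hqF.trans hlt'.le) 2
  choose p hpB hpC hpF using hex
  -- The midpoint of `p i` and `p k` is in `B`, hence at distance at least `e` from `F`; the
  -- parallelogram law gives `2 * (1 / 2) ^ i + 2 * (1 / 2) ^ k`.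
  have hcauchy : ∀ i k, i ≤ k → ‖p i - p k‖ ^ 2 ≤ 4 * (1 / 2) ^ i := by
    intro i k hik
    have h1 := parallelogram_law_with_norm ℂ (F - p i) (F - p k)
    have h2 : F - p i + (F - p k) = (2 : ℂ) • (F - (1 / 2 : ℂ) • (p i + p k)) := by
      ext n x
      simp
      ring
    have h3 : ‖F - p i + (F - p k)‖ = 2 * ‖F - (1 / 2 : ℂ) • (p i + p k)‖ := by
      rw [h2, norm_smul]; simp
    have h4 := he _ (smul_mem (1 / 2 : ℂ) (add_mem (hpB i) (hpB k)))
    have h5 : ‖F - p i - (F - p k)‖ = ‖p i - p k‖ := by rw [sub_sub_sub_cancel_left, norm_sub_rev]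
    rw [h3, h5] at h1
    have h6 : ((1 : ℝ) / 2) ^ k ≤ (1 / 2) ^ i :=
      pow_le_pow_of_le_one (by norm_num) (by norm_num) hik
    nlinarith [hpF i, hpF k, pow_le_pow_left₀ he0 h4 2]
  -- Saturation stands in for completeness: the diagonal sequence is bounded by `C`, because the
  -- minimizers were clamped, and is a limit of the `p i`. The slack from 4 to 5 makes the limit
  -- inequalities hold at actual stages.
  obtain ⟨κ, hκ⟩ := exists_diagonal (fun k n => ∀ i ∈ Finset.range (k + 1),
      ∫ x, ‖(p i - p k).fn n x‖ ^ 2 ∂S.μ n ≤ 5 * (1 / 2) ^ i) (by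
    intro k
    rw [Filter.eventually_all_finset]
    intro i hi
    have hi' : i ≤ k := Nat.lt_succ_iff.1 (Finset.mem_range.1 hi)
    refine ((p i - p k).tendsto_norm_sq.eventually_lt_const ?_).mono fun n hn => hn.le
    have : (0 : ℝ) < (1 / 2) ^ i := by positivity
    linarith [hcauchy i k hi'])
  set P : S.BF := BF.mk (fun n => (p (κ n)).fn n) (fun n => (p (κ n)).measurable n) C
    fun n x => hpC (κ n) n x
  have hPp : ∀ i, ‖p i - P‖ ^ 2 ≤ 5 * (1 / 2) ^ i := by
    intro i
    refine le_of_tendsto (p i - P).tendsto_norm_sq ?_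
    filter_upwards [hκ i] with n hn
    exact hn.2 i (Finset.mem_range.2 (Nat.lt_succ_iff.2 hn.1))
  have hlim : Tendsto (fun i : ℕ => √(5 * (1 / 2 : ℝ) ^ i)) atTop (𝓝 0) := by
    have : Tendsto (fun i : ℕ => 5 * (1 / 2 : ℝ) ^ i) atTop (𝓝 0) := by
      simpa using (tendsto_pow_atTop_nhds_zero_of_lt_one (r := (1 / 2 : ℝ)) (by norm_num)
        (by norm_num)).const_mul 5
    simpa using this.sqrt
  have hPp' : ∀ i, ‖p i - P‖ ≤ √(5 * (1 / 2 : ℝ) ^ i) := fun i => Real.le_sqrt_of_sq_le (hPp i)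
  have hPB : P ∈ B := by
    refine mem_of_approx fun δ hδ => ?_
    obtain ⟨i, hi⟩ := (hlim.eventually_lt_const hδ).exists
    refine ⟨p i, hpB i, ?_⟩
    rw [norm_sub_rev]
    exact (hPp' i).trans hi.le
  have hFP : ‖F - P‖ ≤ e := by
    have h1 : ∀ i, ‖F - P‖ ≤ √(e ^ 2 + (1 / 2) ^ i) + √(5 * (1 / 2 : ℝ) ^ i) := fun i =>
      (norm_sub_le_norm_sub_add_norm_sub F (p i) P).trans
        (add_le_add (Real.le_sqrt_of_sq_le (hpF i)) (hPp' i))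
    refine ge_of_tendsto' (x := atTop) (f := fun i : ℕ => √(e ^ 2 + (1 / 2) ^ i) + √(5 * (1 / 2 : ℝ) ^ i)) ?_ h1
    have h2 : Tendsto (fun i : ℕ => e ^ 2 + (1 / 2 : ℝ) ^ i) atTop (𝓝 (e ^ 2 + 0)) :=
      (tendsto_pow_atTop_nhds_zero_of_lt_one (by norm_num) (by norm_num)).const_add _
    have h3 := h2.sqrt.add hlim
    rwa [add_zero, add_zero, Real.sqrt_sq he0] at h3
  refine ⟨P, hPB, fun H hH => inner_eq_zero_of_norm_le fun t => ?_⟩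
  rw [sub_sub]
  exact hFP.trans (he _ (add_mem hPB (smul_mem t hH)))

/-- A factor is its own double orthogonal complement: apply the hypothesis to the error of the
projection. -/
theorem mem_of_forall_orthogonal {F : S.BF}
    (h : ∀ R : S.BF, (∀ H ∈ B, inner ℂ H R = 0) → inner ℂ F R = 0) : F ∈ B := by
  obtain ⟨P, hP, hR⟩ := B.exists_proj F
  refine mem_of_norm_sub hP ?_
  have h1 : inner ℂ (F - P) (F - P) = (0 : ℂ) := by
    rw [inner_sub_left, h _ hR, hR P hP, sub_zero]
  rw [inner_self_eq_norm_sq_to_K] at h1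
  have h2 : ((‖F - P‖ : ℝ) : ℂ) ^ 2 = 0 := h1
  exact_mod_cast pow_eq_zero_iff two_ne_zero |>.1 h2

end Factor

/-! ### Families of functions and their averages -/

/-- A uniformly bounded family of measurable functions, indexed at stage `n` by `J n`. -/
structure IFam (S : SysSeq.{u, v}) (J : ℕ → Type w) where
  fn : ∀ n, J n → S.X n → ℂ
  meas : ∀ n j, Measurable (fn n j)
  bound : ∃ C : ℝ, 0 < C ∧ ∀ n j x, ‖fn n j x‖ ≤ C

namespace IFam

variable {J : ℕ → Type w} {K : ℕ → Type w'}

/-- The member of the family for a sequence of indices. -/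
def at' (c : S.IFam J) (j : ∀ n, J n) : S.BF :=
  BF.mk (fun n => c.fn n (j n)) (fun n => c.meas n _) c.bound.choose
    fun n x => c.bound.choose_spec.2 n _ x

@[simp] theorem at'_fn (c : S.IFam J) (j : ∀ n, J n) (n x) :
    (c.at' j).fn n x = c.fn n (j n) x := rfl

/-- Pointwise products. -/
def mul (c d : S.IFam J) : S.IFam J where
  fn n j x := c.fn n j x * d.fn n j x
  meas n j := (c.meas n j).mul (d.meas n j)
  bound := by
    obtain ⟨C, hC, hc⟩ := c.bound
    obtain ⟨D, hD, hd⟩ := d.bound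
    refine ⟨C * D, by positivity, fun n j x => ?_⟩
    rw [norm_mul]
    exact mul_le_mul (hc n j x) (hd n j x) (norm_nonneg _) hC.le

/-- Pointwise conjugates. -/
def conj (c : S.IFam J) : S.IFam J where
  fn n j x := (starRingEnd ℂ) (c.fn n j x)
  meas n j := Complex.continuous_conj.measurable.comp (c.meas n j)
  bound := by
    obtain ⟨C, hC, hc⟩ := c.bound
    exact ⟨C, hC, fun n j x => by simpa using hc n j x⟩

/-- Change of index set. -/
def reindex (c : S.IFam J) (φ : ∀ n, K n → J n) : S.IFam K where
  fn n k := c.fn n (φ n k)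
  meas n k := c.meas n _
  bound := by
    obtain ⟨C, hC, hc⟩ := c.bound
    exact ⟨C, hC, fun n j x => hc n _ x⟩

/-- Translation by an index-dependent group element. -/
def trans (c : S.IFam J) (t : ∀ n, J n → S.G n) : S.IFam J where
  fn n j x := c.fn n j (-(t n j) +ᵥ x)
  meas n j := (c.meas n j).comp ((S.sys n).measurePreserving _).measurable
  bound := by
    obtain ⟨C, hC, hc⟩ := c.bound
    exact ⟨C, hC, fun n j x => hc n j _⟩

/-- The constant family. -/
def const (J : ℕ → Type w) (F : S.BF) : S.IFam J where
  fn n _ := F.fn n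
  meas n _ := F.measurable n
  bound := by
    obtain ⟨C, hC, hc⟩ := F.exists_bound
    exact ⟨C, hC, fun n _ x => hc n x⟩

@[simp] theorem mul_at' (c d : S.IFam J) (j) : (c.mul d).at' j = c.at' j * d.at' j := rfl
@[simp] theorem reindex_at' (c : S.IFam J) (φ : ∀ n, K n → J n) (k : ∀ n, K n) :
    (c.reindex φ).at' k = c.at' fun n => φ n (k n) := rfl

variable [∀ n, Fintype (J n)] [∀ n, Nonempty (J n)]

/-- The average of the family. -/
def avg (c : S.IFam J) : S.BF :=
  BF.mk (fun n x => 𝔼 j, c.fn n j x) (fun n => measurable_expect fun j => c.meas n j)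
    c.bound.choose fun n x => norm_expect_le_of_le fun j => c.bound.choose_spec.2 n j x

@[simp] theorem avg_fn (c : S.IFam J) (n x) : c.avg.fn n x = 𝔼 j, c.fn n j x := rfl

theorem norm_avg_fn_le (c : S.IFam J) {C : ℝ} (hC : ∀ n j x, ‖c.fn n j x‖ ≤ C) (n x) :
    ‖c.avg.fn n x‖ ≤ C := norm_expect_le_of_le fun j => hC n j x

theorem exists_norm_inner_avg_le (c : S.IFam J) (H : S.BF) :
    ∃ j, ‖inner ℂ H c.avg‖ ≤ ‖inner ℂ H (c.at' j)‖ := by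
  have h1 : ∀ n, ∫ x, (starRingEnd ℂ) (H.fn n x) * c.avg.fn n x ∂S.μ n =
      𝔼 j, ∫ x, (starRingEnd ℂ) (H.fn n x) * c.fn n j x ∂S.μ n := by
    intro n
    -- `at'` expects an index for every stage, so `j` is placed at stage `n` of an arbitrary
    -- sequence merely to obtain integrability.
    rw [← integral_expect fun j => (star H * c.at' (Function.update (fun n => Classical.arbitrary _)
      n j)).integrable n |>.congr (Filter.Eventually.of_forall fun x => by simp)]
    simp only [avg_fn, Finset.mul_expect]
  choose j hj using fun n => exists_norm_expect_le
    fun j => ∫ x, (starRingEnd ℂ) (H.fn n x) * c.fn n j x ∂S.μ n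
  refine ⟨j, le_of_tendsto_of_tendsto' (BF.tendsto_inner H c.avg).norm
    (BF.tendsto_inner H (c.at' j)).norm fun n => ?_⟩
  rw [h1]
  exact hj n

/-- If the average correlates with some `R` orthogonal to `B`, then so does the member for some
sequence of indices. No uniformity over the index sets, which may grow with `n`, is required. -/
theorem avg_mem {B : S.Factor} (c : S.IFam J) (hc : ∀ j, c.at' j ∈ B) : c.avg ∈ B := by
  refine Factor.mem_of_forall_orthogonal fun R hR => ?_
  obtain ⟨j, hj⟩ := c.exists_norm_inner_avg_le R
  have h0 : inner ℂ R (c.at' j) = 0 := by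
    rw [← inner_conj_symm, hR _ (hc j), map_zero]
  rw [h0, norm_zero] at hj
  rw [← inner_conj_symm, norm_le_zero_iff.1 hj, map_zero]

end IFam

end SysSeq

theorem expect_prod {α β M : Type*} [Fintype α] [Fintype β] [AddCommMonoid M] [Module ℚ≥0 M]
    (f : α × β → M) :
    𝔼 p, f p = 𝔼 a, 𝔼 b, f (a, b) := by
  rw [← Finset.univ_product_univ, Finset.expect_product]

/-- A sum of two averages as one uniform average: the factor 2 makes up for each branch having
weight one half. -/
theorem expect_prod_bool {α β : Type*} [Fintype α] [Nonempty α] [Fintype β] [Nonempty β]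
    (a : α → ℂ) (b : β → ℂ) :
    𝔼 p : (α × β) × Bool, (if p.2 then 2 * a p.1.1 else 2 * b p.1.2) = 𝔼 i, a i + 𝔼 i, b i := by
  have h : ∀ x y : ℂ, 𝔼 t : Bool, (if t then 2 * x else 2 * y) = x + y := by
    intro x y
    rw [Fintype.expect_eq_sum_div_card, Fintype.sum_bool]
    simp
    ring
  simp only [expect_prod, h, Finset.expect_add_distrib, Fintype.expect_const]

theorem norm_expect_sub_le {ι : Type*} [Fintype ι] [Nonempty ι] {f g : ι → ℂ} {C : ℝ}
    (h : ∀ i, ‖f i - g i‖ ≤ C) : ‖𝔼 i, f i - 𝔼 i, g i‖ ≤ C := by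
  rw [← Finset.expect_sub_distrib]
  exact norm_expect_le_of_le h

/-- The multiset of values of a finite indexed family. -/
def valueMultiset {J G : Type*} [Fintype J] (q : J → G) : Multiset G := Finset.univ.val.map q

theorem multisetAvg_valueMultiset {J G : Type*} [Fintype J] (q : J → G) (F : G → ℂ) :
    multisetAvg (valueMultiset q) F = 𝔼 j, F (q j) := by
  simp [multisetAvg, valueMultiset, Fintype.expect_eq_sum_div_card]

/-! ### Dual functions -/

section Dual

variable {G : Type*} [AddCommGroup G] {X : Type*} [AddAction G X]

theorem norm_multDeriv_le {f : X → ℂ} {C : ℝ} (hf : ∀ x, ‖f x‖ ≤ C) (h h' : G) (x : X) :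
    ‖multDeriv h h' f x‖ ≤ C * C := by
  simp only [multDeriv, norm_mul, RCLike.norm_conj]
  exact mul_le_mul (hf _) (hf _) (norm_nonneg _) ((norm_nonneg _).trans (hf x))

theorem measurable_multDeriv [MeasurableSpace X] {f : X → ℂ} (hf : Measurable f)
    (hT : ∀ g : G, Measurable fun x : X => g +ᵥ x) (h h' : G) : Measurable (multDeriv h h' f) :=
  (hf.comp (hT _)).mul (Complex.continuous_conj.measurable.comp (hf.comp (hT _)))

variable {J : Type*} [Fintype J]

theorem gowersAvg_succ [MeasurableSpace X] (μ : Measure X) (q : J → G) (d : ℕ) (f : X → ℂ) :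
    gowersAvg μ (valueMultiset q) (d + 1) f =
      𝔼 h, 𝔼 h', gowersAvg μ (valueMultiset q) d (multDeriv (q h) (q h') f) := by
  simp only [gowersAvg, multisetAvg_valueMultiset]

/-- The dual function associated with the Gowers average along `q`. -/
def dualFn (q : J → G) : ℕ → (X → ℂ) → X → ℂ
  | 0, _ => fun _ => 1
  | d + 1, f => fun x => 𝔼 h, 𝔼 h',
      f (-(q h' - q h) +ᵥ x) * dualFn q d (multDeriv (q h) (q h') f) (q h +ᵥ x)

/-- A bound for dual functions of functions bounded by `C`. -/
def dualBound : ℕ → ℝ → ℝ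
  | 0, _ => 1
  | d + 1, C => C * dualBound d (C * C)

theorem dualBound_nonneg (d : ℕ) {C : ℝ} (hC : 0 ≤ C) : 0 ≤ dualBound d C := by
  induction d generalizing C with
  | zero => exact zero_le_one
  | succ d ih => exact mul_nonneg hC (ih (mul_nonneg hC hC))

theorem dualBound_one (d : ℕ) : dualBound d 1 = 1 := by
  induction d with
  | zero => rfl
  | succ d ih => simp [dualBound, ih]

theorem norm_dualFn_le [Nonempty J] (q : J → G) (d : ℕ) {f : X → ℂ} {C : ℝ} (hC : 0 ≤ C)
    (hf : ∀ x, ‖f x‖ ≤ C) (x : X) : ‖dualFn q d f x‖ ≤ dualBound d C := by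
  induction d generalizing f C x with
  | zero => simp [dualFn, dualBound]
  | succ d ih =>
    refine norm_expect_le_of_le fun h => norm_expect_le_of_le fun h' => ?_
    rw [norm_mul]
    exact mul_le_mul (hf _) (ih (mul_nonneg hC hC) (norm_multDeriv_le hf _ _) _) (norm_nonneg _) hC

theorem measurable_dualFn [MeasurableSpace X] (q : J → G) (d : ℕ) {f : X → ℂ} (hf : Measurable f)
    (hT : ∀ g : G, Measurable fun x : X => g +ᵥ x) : Measurable (dualFn q d f) := by
  induction d generalizing f with
  | zero => exact measurable_const
  | succ d ih =>
    refine measurable_expect fun h => measurable_expect fun h' => (hf.comp (hT _)).mul ?_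
    exact (ih (measurable_multDeriv hf hT _ _)).comp (hT _)

/-- The Gowers average is the correlation with the dual function. -/
theorem integral_conj_dualFn_mul [Nonempty J] [MeasurableSpace X] {μ : Measure X}
    (hμ : IsGSystem G μ) (q : J → G) (d : ℕ) {f : X → ℂ} (hf : Measurable f) {C : ℝ}
    (hC : 0 ≤ C) (hfC : ∀ x, ‖f x‖ ≤ C) :
    ∫ x, (starRingEnd ℂ) (dualFn q d f x) * f x ∂μ = gowersAvg μ (valueMultiset q) d f := by
  have := hμ.isProbabilityMeasure
  have hT : ∀ g : G, Measurable fun x : X => g +ᵥ x := fun g => (hμ.measurePreserving g).measurable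
  have hint : ∀ {F : X → ℂ} {D : ℝ}, Measurable F → (∀ x, ‖F x‖ ≤ D) → Integrable F μ :=
    fun hF hD => Integrable.of_bound hF.aestronglyMeasurable _ (Filter.Eventually.of_forall hD)
  induction d generalizing f C with
  | zero => simp [dualFn, gowersAvg]
  | succ d ih =>
    rw [gowersAvg_succ]
    have hm : ∀ h h', Measurable fun x => (starRingEnd ℂ) (f (-(q h' - q h) +ᵥ x) *
        dualFn q d (multDeriv (q h) (q h') f) (q h +ᵥ x)) * f x := fun h h' =>
      (Complex.continuous_conj.measurable.comp ((hf.comp (hT _)).mul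
        ((measurable_dualFn q d (measurable_multDeriv hf hT _ _) hT).comp (hT _)))).mul hf
    have hb : ∀ h h' x, ‖(starRingEnd ℂ) (f (-(q h' - q h) +ᵥ x) *
        dualFn q d (multDeriv (q h) (q h') f) (q h +ᵥ x)) * f x‖ ≤
          (C * dualBound d (C * C)) * C := by
      intro h h' x
      rw [norm_mul, RCLike.norm_conj, norm_mul]
      have h2 := norm_dualFn_le q d (mul_nonneg hC hC) (norm_multDeriv_le hfC (q h) (q h'))
        (q h +ᵥ x)
      have h3 := dualBound_nonneg d (mul_nonneg hC hC)
      gcongr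
      · exact hfC _
      · exact hfC _
    have e1 : ∀ x, (starRingEnd ℂ) (dualFn q (d + 1) f x) * f x = 𝔼 h, 𝔼 h',
        (starRingEnd ℂ) (f (-(q h' - q h) +ᵥ x) *
          dualFn q d (multDeriv (q h) (q h') f) (q h +ᵥ x)) * f x := by
      intro x
      simp only [dualFn, star_expect, Finset.expect_mul]
    simp only [e1]
    rw [integral_expect fun h => hint (measurable_expect fun h' => hm h h') fun x =>
      norm_expect_le_of_le fun h' => hb h h' x]
    refine Finset.expect_congr rfl fun h _ => ?_
    rw [integral_expect fun h' => hint (hm h h') fun x => hb h h' x]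
    refine Finset.expect_congr rfl fun h' _ => ?_
    rw [← ih (measurable_multDeriv hf hT (q h) (q h')) (mul_nonneg hC hC)
      (norm_multDeriv_le hfC _ _)]
    -- Translating by `q h` strips the shift from the first factor of the derivative, leaving `f`
    -- itself.
    have hmp := hμ.measurePreserving (q h)
    have h2 := integral_map (μ := μ) hmp.measurable.aemeasurable
      (f := fun x => (starRingEnd ℂ) (dualFn q d (multDeriv (q h) (q h') f) x) *
        multDeriv (q h) (q h') f x)
      ((Complex.continuous_conj.measurable.comp
        (measurable_dualFn q d (measurable_multDeriv hf hT _ _) hT)).mul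
        (measurable_multDeriv hf hT _ _)).aestronglyMeasurable
    rw [hmp.map_eq] at h2
    rw [h2]
    refine integral_congr_ae (Filter.Eventually.of_forall fun x => ?_)
    simp only [multDeriv, sysTranslate, map_mul, vadd_vadd, neg_add_cancel, zero_vadd, neg_sub]
    rw [show -q h' + q h = q h - q h' by abel]
    ring

end Dual

namespace SysSeq

variable {S : SysSeq.{u, v}}

theorem measurable_vadd (S : SysSeq.{u, v}) (n : ℕ) (g : S.G n) :
    Measurable fun x : S.X n => g +ᵥ x := ((S.sys n).measurePreserving g).measurable

namespace BF

/-- The multiplicative derivative. -/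
def delta (h h' : ∀ n, S.G n) (F : S.BF) : S.BF := tr h F * star (tr h' F)

theorem delta_fn (h h' : ∀ n, S.G n) (F : S.BF) (n : ℕ) :
    (delta h h' F).fn n = multDeriv (h n) (h' n) (F.fn n) := rfl

theorem delta_mem {B : S.Factor} {F : S.BF} (hF : F ∈ B) (h h' : ∀ n, S.G n) :
    delta h h' F ∈ B :=
  Factor.mul_mem (Factor.tr_mem _ hF) (Factor.star_mem (Factor.tr_mem _ hF))

section

variable {J : ℕ → Type w}

/-- The translated first factors in the definition of the dual function. -/
def shiftFam (q : ∀ n, J n → S.G n) (F : S.BF) : S.IFam fun n => J n × J n :=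
  (IFam.const _ F).trans fun n p => q n p.2 - q n p.1

theorem shiftFam_at'_mem {B : S.Factor} {F : S.BF} (hF : F ∈ B) (q : ∀ n, J n → S.G n)
    (j : ∀ n, J n × J n) : (shiftFam q F).at' j ∈ B := Factor.tr_mem _ hF

variable [∀ n, Fintype (J n)] [∀ n, Nonempty (J n)]

/-- The sequence of dual functions. -/
def dual (q : ∀ n, J n → S.G n) (d : ℕ) (F : S.BF) : S.BF :=
  mk (fun n => dualFn (q n) d (F.fn n))
    (fun n => measurable_dualFn _ _ (F.measurable n) (S.measurable_vadd n))
    (dualBound d F.exists_bound.choose) fun n x =>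
      norm_dualFn_le _ _ F.exists_bound.choose_spec.1.le (F.exists_bound.choose_spec.2 n) x

theorem dual_fn (q : ∀ n, J n → S.G n) (d : ℕ) (F : S.BF) (n : ℕ) :
    (dual q d F).fn n = dualFn (q n) d (F.fn n) := rfl

theorem tendsto_gowersAvg (q : ∀ n, J n → S.G n) (d : ℕ) (F : S.BF) :
    Tendsto (fun n => gowersAvg (S.μ n) (valueMultiset (q n)) d (F.fn n)) limitFilter
      (𝓝 (inner ℂ (dual q d F) F)) := by
  obtain ⟨C, hC, hF⟩ := F.exists_bound
  refine (tendsto_inner (dual q d F) F).congr fun n => ?_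
  exact integral_conj_dualFn_mul (S.sys n) (q n) d (F.measurable n) hC.le (hF n)

/-- The coefficients of a translate of the dual function. -/
def coefFam (q : ∀ n, J n → S.G n) (d : ℕ) (F : S.BF) :
    S.IFam fun n => S.G n × (J n × J n) where
  fn n p x := dualFn (q n) d (multDeriv (q n p.2.1 + p.1) (q n p.2.2) (F.fn n)) (q n p.2.1 +ᵥ x)
  meas n p := (measurable_dualFn _ _ (measurable_multDeriv (F.measurable n) (S.measurable_vadd n)
    _ _) (S.measurable_vadd n)).comp (S.measurable_vadd n _)
  bound := by
    obtain ⟨C, hC, hF⟩ := F.exists_bound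
    exact ⟨dualBound d (C * C) + 1, by have := dualBound_nonneg d (mul_nonneg hC.le hC.le); linarith,
      fun n p x => (norm_dualFn_le _ _ (mul_nonneg hC.le hC.le)
        (norm_multDeriv_le (hF n) _ _) _).trans (by linarith)⟩

/-- The coefficients are translates of dual functions of one degree less, so they belong to any
factor that contains those. -/
theorem coefFam_at' (q : ∀ n, J n → S.G n) (d : ℕ) (F : S.BF) (s : ∀ n, S.G n)
    (j : ∀ n, J n × J n) : (coefFam q d F).at' (fun n => (s n, j n)) =
      tr (fun n => -(q n (j n).1)) (dual q d (delta (fun n => q n (j n).1 + s n)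
        (fun n => q n (j n).2) F)) := by
  ext n x
  simp [coefFam, tr_fn, dual_fn, delta_fn]

theorem dual_succ_eq (q : ∀ n, J n → S.G n) (d : ℕ) (F : S.BF) :
    dual q (d + 1) F =
      (((coefFam q d F).reindex fun n (p : J n × J n) => ((0 : S.G n), p)).mul
        (shiftFam q F)).avg := by
  ext n x
  simp only [dual_fn, dualFn, IFam.avg_fn, expect_prod, IFam.mul, IFam.reindex, shiftFam, coefFam,
    IFam.trans, IFam.const, add_zero]
  refine Finset.expect_congr rfl fun h _ => Finset.expect_congr rfl fun h' _ => ?_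
  ring

theorem dual_mem {B : S.Factor} (q : ∀ n, J n → S.G n) (d : ℕ) {F : S.BF} (hF : F ∈ B) :
    dual q d F ∈ B := by
  induction d generalizing F with
  | zero => exact B.one_mem
  | succ d ih =>
    rw [dual_succ_eq]
    refine IFam.avg_mem _ fun j => ?_
    have := coefFam_at' q d F 0 j
    simp only [Pi.zero_apply] at this
    rw [IFam.mul_at', IFam.reindex_at', this]
    exact Factor.mul_mem (Factor.tr_mem _ (ih (delta_mem hF _ _))) (shiftFam_at'_mem hF q j)

end

end BF

/-! ### Scales, infinitesimals and represented translates -/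

variable (S) in
/-- A decreasing sequence of averaging scales, each almost invariant under translation by elements
of much finer scales. -/
structure Scale where
  J : ℕ → ℕ → Type
  [instF : ∀ k n, Fintype (J k n)]
  [instN : ∀ k n, Nonempty (J k n)]
  q : ∀ k n, J k n → S.G n
  anti : ∀ k l n, k ≤ l → Set.range (q l n) ⊆ Set.range (q k n)
  inv : ∀ k, ∀ η > 0, ∃ l, ∀ n, ∀ j : J l n, ∀ φ : S.G n → ℂ, (∀ g, ‖φ g‖ ≤ 1) →
    ‖𝔼 i, φ (q k n i + q l n j) - 𝔼 i, φ (q k n i)‖ ≤ η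

attribute [instance] Scale.instF Scale.instN

namespace Scale

variable (σ : S.Scale)

/-- Sequences of group elements that are eventually in every scale. -/
def Inf (s : ∀ n, S.G n) : Prop := ∀ k, ∀ᶠ n in limitFilter, s n ∈ Set.range (σ.q k n)

variable {σ}

theorem Inf.almost_invariant {s : ∀ n, S.G n} (hs : σ.Inf s) (k : ℕ) (D η : ℝ) (hη : 0 < η) :
    ∀ᶠ n in limitFilter, ∀ φ : S.G n → ℂ, (∀ g, ‖φ g‖ ≤ D) →
      ‖𝔼 i, φ (σ.q k n i + s n) - 𝔼 i, φ (σ.q k n i)‖ ≤ η := by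
  set D' := max D 1
  have hD' : 0 < D' := by positivity
  obtain ⟨l, hl⟩ := σ.inv k (η / D') (by positivity)
  filter_upwards [hs l] with n ⟨j, hj⟩ φ hφ
  have h1 := hl n j (fun g => φ g / D') fun g => by
    rw [norm_div, Complex.norm_real, Real.norm_of_nonneg hD'.le, div_le_one hD']
    exact (hφ g).trans (le_max_left _ _)
  rw [← Finset.expect_div, ← Finset.expect_div, ← sub_div, norm_div, Complex.norm_real,
    Real.norm_of_nonneg hD'.le, hj] at h1
  exact (div_le_div_iff_of_pos_right hD').1 h1

variable (σ)

/-- Translating by an infinitesimal `s` and then substituting `h + s` for `h` in the average costs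
nothing in the limit. After the substitution the shifts of `F` are free of `s`, which survives only
in the dual functions of lower degree. This motivates the definition of `Represents`. -/
theorem norm_tr_dual_sub {s : ∀ n, S.G n} (hs : σ.Inf s) (k d : ℕ) (F : S.BF) :
    ‖(BF.dual (σ.q k) (d + 1) F).tr s - (((BF.coefFam (σ.q k) d F).reindex
      fun n (p : σ.J k n × σ.J k n) => (s n, p)).mul (BF.shiftFam (σ.q k) F)).avg‖ = 0 := by
  refine le_antisymm (le_of_forall_pos_le_add fun η hη => ?_) (norm_nonneg _)
  rw [zero_add]
  obtain ⟨C, hC, hF⟩ := F.exists_bound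
  refine BF.norm_le_of_bound hη.le ?_
  filter_upwards [hs.almost_invariant k (C * dualBound d (C * C)) η hη] with n hn x
  simp only [BF.sub_fn, BF.tr_fn, BF.dual_fn, dualFn, IFam.avg_fn, expect_prod, IFam.mul,
    IFam.reindex, BF.shiftFam, BF.coefFam, IFam.trans, IFam.const]
  rw [Finset.expect_comm (M := ℂ)]
  conv_lhs => enter [1, 2]; rw [Finset.expect_comm (M := ℂ)]
  refine norm_expect_sub_le fun h' => ?_
  have h1 := hn (fun g => F.fn n (-(σ.q k n h' - g) +ᵥ (-s n +ᵥ x)) *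
    dualFn (σ.q k n) d (multDeriv g (σ.q k n h') (F.fn n)) (g +ᵥ (-s n +ᵥ x))) fun g => by
      rw [norm_mul]
      exact mul_le_mul (hF n _) (norm_dualFn_le _ _ (mul_nonneg hC.le hC.le)
        (norm_multDeriv_le (hF n) _ _) _) (norm_nonneg _) hC.le
  rw [norm_sub_rev] at h1
  refine le_trans (le_of_eq ?_) h1
  congr 2
  refine Finset.expect_congr (M := ℂ) rfl fun h _ => ?_
  rw [mul_comm, vadd_vadd, vadd_vadd]
  congr 3
  · abel
  · abel

/-- The factor of functions invariant under infinitesimal translations. -/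
def invFactor : S.Factor where
  carrier := {F | ∀ s, σ.Inf s → ‖F.tr s - F‖ = 0}
  algebraMap_mem' z s _ := by
    rw [BF.tr_algebraMap, sub_self, norm_zero]
  add_mem' := by
    intro F H hF hH s hs
    refine le_antisymm ?_ (norm_nonneg _)
    have h1 : (F + H).tr s - (F + H) = (F.tr s - F) + (H.tr s - H) := by
      rw [BF.tr_add]; abel
    rw [h1]
    refine (norm_add_le _ _).trans ?_
    rw [hF s hs, hH s hs, add_zero]
  mul_mem' := by
    intro F H hF hH s hs
    refine le_antisymm ?_ (norm_nonneg _)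
    have h1 : (F * H).tr s - F * H = F.tr s * (H.tr s - H) + H * (F.tr s - F) := by
      rw [BF.tr_mul]; ring
    obtain ⟨C, hC, hCF⟩ := F.exists_bound
    obtain ⟨D, hD, hDH⟩ := H.exists_bound
    rw [h1]
    refine (norm_add_le _ _).trans ?_
    have h2 := BF.norm_mul_le_of_bound (F := F.tr s) (H := H.tr s - H) hC.le
      (Filter.Eventually.of_forall fun n x => hCF n _)
    have h3 := BF.norm_mul_le_of_bound (F := H) (H := F.tr s - F) hD.le
      (Filter.Eventually.of_forall fun n x => hDH n _)
    rw [hH s hs, mul_zero] at h2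
    rw [hF s hs, mul_zero] at h3
    linarith
  star_mem' := by
    intro F hF s hs
    rw [BF.tr_star, ← star_sub, BF.norm_star]
    exact hF s hs
  closed' F h s hs := by
    refine le_antisymm (le_of_forall_pos_le_add fun κ hκ => ?_) (norm_nonneg _)
    obtain ⟨P, hP, hFP⟩ := h (κ / 2) (by positivity)
    have h1 : F.tr s - F = (F - P).tr s + (P.tr s - P) - (F - P) := by
      rw [BF.tr_sub]; abel
    rw [h1]
    refine (norm_sub_le _ _).trans ((add_le_add_left (norm_add_le _ _) _).trans ?_)
    rw [BF.norm_tr, hP s hs]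
    linarith
  tr_mem' t F hF s hs := by
    have h1 : (F.tr t).tr s - F.tr t = (F.tr s - F).tr t := by
      rw [BF.tr_sub, BF.tr_tr, BF.tr_tr, add_comm]
    rw [h1, BF.norm_tr]
    exact hF s hs

/-- `F` admits a representation of its infinitesimal translates, up to `κ`, by averages of
products of elements of a fixed family in `B` with coefficients in `C`. -/
def Represents (C B : S.Factor) (F : S.BF) (κ : ℝ) : Prop :=
  ∃ (J : ℕ → Type) (_ : ∀ n, Fintype (J n)) (_ : ∀ n, Nonempty (J n))
    (c : S.IFam fun n => S.G n × J n) (g : S.IFam J),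
    (∀ s, σ.Inf s → ∀ j : ∀ n, J n, c.at' (fun n => (s n, j n)) ∈ C) ∧ (∀ j, g.at' j ∈ B) ∧
      ∀ s, σ.Inf s → ‖F.tr s - ((c.reindex fun n (j : J n) => (s n, j)).mul g).avg‖ ≤ κ

variable {σ}

/-- The index set ought to be a disjoint union with equal weight on both parts. Since averages are
uniform, it is modelled by `(J × J') × Bool`, with the factor 2 put into the fixed family. -/
theorem Represents.add {C B : S.Factor} {F F' : S.BF} {κ κ' : ℝ} (hF : σ.Represents C B F κ)
    (hF' : σ.Represents C B F' κ') : σ.Represents C B (F + F') (κ + κ') := by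
  obtain ⟨J, _, _, c, g, hc, hg, h⟩ := hF
  obtain ⟨J', _, _, c', g', hc', hg', h'⟩ := hF'
  obtain ⟨b₁, hb₁, hcb⟩ := c.bound
  obtain ⟨b₁', hb₁', hcb'⟩ := c'.bound
  obtain ⟨b₂, hb₂, hgb⟩ := g.bound
  obtain ⟨b₂', hb₂', hgb'⟩ := g'.bound
  refine ⟨fun n => (J n × J' n) × Bool, inferInstance, inferInstance,
    ⟨fun n p => if p.2.2 then c.fn n (p.1, p.2.1.1) else c'.fn n (p.1, p.2.1.2),
      fun n p => by split_ifs; exacts [c.meas n _, c'.meas n _],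
      b₁ + b₁', by positivity, fun n p x => by
        split_ifs
        exacts [(hcb n _ x).trans (by linarith), (hcb' n _ x).trans (by linarith)]⟩,
    ⟨fun n p => if p.2 then fun x => 2 * g.fn n p.1.1 x else fun x => 2 * g'.fn n p.1.2 x,
      fun n p => by split_ifs; exacts [(g.meas n _).const_mul 2, (g'.meas n _).const_mul 2],
      2 * b₂ + 2 * b₂', by positivity, fun n p x => by
        split_ifs
        · rw [norm_mul, RCLike.norm_ofNat]; linarith [hgb n p.1.1 x]
        · rw [norm_mul, RCLike.norm_ofNat]; linarith [hgb' n p.1.2 x]⟩, ?_, ?_, ?_⟩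
  · intro s hs j
    refine Factor.mem_of_forall_or (hc s hs fun n => (j n).1.1) (hc' s hs fun n => (j n).1.2)
      fun n => ?_
    rcases hj : (j n).2 with _ | _
    · right; intro x; simp [hj]
    · left; intro x; simp [hj]
  · intro j
    refine Factor.mem_of_forall_or (Factor.smul_mem 2 (hg fun n => (j n).1.1))
      (Factor.smul_mem 2 (hg' fun n => (j n).1.2)) fun n => ?_
    rcases hj : (j n).2 with _ | _
    · right; intro x; simp [hj]
    · left; intro x; simp [hj]
  · intro s hs
    refine le_trans (le_of_eq ?_) ((norm_add_le _ _).trans (add_le_add (h s hs) (h' s hs)))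
    congr 1
    ext n x
    have h1 := expect_prod_bool (fun j => c.fn n (s n, j) x * g.fn n j x)
      (fun j => c'.fn n (s n, j) x * g'.fn n j x)
    simp only [BF.sub_fn, BF.add_fn, BF.tr_fn, IFam.avg_fn, IFam.mul, IFam.reindex]
    rw [sub_add_sub_comm, ← h1]
    congr 1
    refine Finset.expect_congr rfl fun p _ => ?_
    split_ifs <;> ring

end Scale

end SysSeq

/-! ### Characteristic factors -/

namespace SysSeq

variable {S : SysSeq.{u, v}}

namespace Scale

variable {σ : S.Scale}

theorem Represents.mono {C B C' B' : S.Factor} {F : S.BF} {κ κ' : ℝ}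
    (hF : σ.Represents C B F κ) (hC : ∀ F, F ∈ C → F ∈ C') (hB : ∀ F, F ∈ B → F ∈ B')
    (hκ : κ ≤ κ') : σ.Represents C' B' F κ' := by
  obtain ⟨J, i1, i2, c, g, hc, hg, h⟩ := hF
  exact ⟨J, i1, i2, c, g, fun s hs j => hC _ (hc s hs j), fun j => hB _ (hg j),
    fun s hs => (h s hs).trans hκ⟩

theorem Represents.of_norm_sub_le {C B : S.Factor} {F P : S.BF} {κ κ' : ℝ}
    (hP : σ.Represents C B P κ) (h : ‖F - P‖ ≤ κ') : σ.Represents C B F (κ' + κ) := by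
  obtain ⟨J, i1, i2, c, g, hc, hg, hPs⟩ := hP
  refine ⟨J, i1, i2, c, g, hc, hg, fun s hs => ?_⟩
  refine (norm_sub_le_norm_sub_add_norm_sub _ (P.tr s) _).trans (add_le_add ?_ (hPs s hs))
  rw [← BF.tr_sub, BF.norm_tr]
  exact h

theorem Represents.star {C B : S.Factor} {F : S.BF} {κ : ℝ}
    (hF : σ.Represents C B F κ) : σ.Represents C B (star F) κ := by
  obtain ⟨J, i1, i2, c, g, hc, hg, h⟩ := hF
  refine ⟨J, i1, i2, c.conj, g.conj, fun s hs j => Factor.star_mem (hc s hs j),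
    fun j => Factor.star_mem (hg j), fun s hs => ?_⟩
  refine le_trans (le_of_eq ?_) (h s hs)
  rw [← BF.norm_star (BF.tr s F - _), star_sub, BF.tr_star]
  congr 2
  ext n x
  simp only [IFam.avg_fn, BF.star_fn, star_expect, IFam.mul, IFam.conj, IFam.reindex, map_mul]

theorem Represents.tr {C B : S.Factor} {F : S.BF} {κ : ℝ}
    (hF : σ.Represents C B F κ) (t : ∀ n, S.G n) : σ.Represents C B (F.tr t) κ := by
  obtain ⟨J, i1, i2, c, g, hc, hg, h⟩ := hF
  refine ⟨J, i1, i2, c.trans fun n _ => t n, g.trans fun n _ => t n,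
    fun s hs j => Factor.tr_mem _ (hc s hs j), fun j => Factor.tr_mem _ (hg j), fun s hs => ?_⟩
  refine le_trans (le_of_eq ?_) (h s hs)
  rw [← BF.norm_tr t (BF.tr s F - _), BF.tr_sub, BF.tr_tr, BF.tr_tr, add_comm]
  rfl

/-- Multiplying the two representations gives one over the product index set. The error for `F` is
multiplied by a bound for the approximant of `F'`, so that approximant is chosen first. -/
theorem Represents.mul {C B : S.Factor} {F F' : S.BF}
    (hF : ∀ κ > 0, σ.Represents C B F κ) (hF' : ∀ κ > 0, σ.Represents C B F' κ) (κ : ℝ)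
    (hκ : 0 < κ) : σ.Represents C B (F * F') κ := by
  obtain ⟨D, hD, hDF⟩ := F.exists_bound
  obtain ⟨J', _, _, c', g', hc', hg', h'⟩ := hF' (κ / (2 * D)) (by positivity)
  obtain ⟨b₁, hb₁, hcb⟩ := (c'.mul (g'.reindex fun n (p : S.G n × J' n) => p.2)).bound
  obtain ⟨J, _, _, c, g, hc, hg, h⟩ := hF (κ / (2 * b₁)) (by positivity)
  refine ⟨fun n => J n × J' n, inferInstance, inferInstance,
    (c.reindex fun n (p : S.G n × (J n × J' n)) => (p.1, p.2.1)).mul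
      (c'.reindex fun n (p : S.G n × (J n × J' n)) => (p.1, p.2.2)),
    (g.reindex fun n (p : J n × J' n) => p.1).mul (g'.reindex fun n (p : J n × J' n) => p.2),
    fun s hs j => Factor.mul_mem (hc s hs _) (hc' s hs _),
    fun j => Factor.mul_mem (hg _) (hg' _), fun s hs => ?_⟩
  set P := ((c.reindex fun n (j : J n) => (s n, j)).mul g).avg
  set P' := ((c'.reindex fun n (j : J' n) => (s n, j)).mul g').avg
  have e1 : ((((c.reindex fun n (p : S.G n × (J n × J' n)) => (p.1, p.2.1)).mul
      (c'.reindex fun n (p : S.G n × (J n × J' n)) => (p.1, p.2.2))).reindex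
        (fun n (p : J n × J' n) => (s n, p))).mul
      ((g.reindex fun n (p : J n × J' n) => p.1).mul
        (g'.reindex fun n (p : J n × J' n) => p.2))).avg = P * P' := by
    ext n x
    simp only [P, P', BF.mul_fn, IFam.avg_fn, IFam.mul, IFam.reindex, expect_prod,
      Finset.expect_mul_expect]
    refine Finset.expect_congr rfl fun j _ => Finset.expect_congr rfl fun j' _ => ?_
    ring
  rw [e1, BF.tr_mul]
  have e2 : F.tr s * F'.tr s - P * P' = F.tr s * (F'.tr s - P') + P' * (F.tr s - P) := by ring
  rw [e2]
  refine (norm_add_le _ _).trans ?_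
  have h1 := BF.norm_mul_le_of_bound (F := F.tr s) (H := F'.tr s - P') hD.le
    (Filter.Eventually.of_forall fun n x => hDF n _)
  have h2 := BF.norm_mul_le_of_bound (F := P') (H := F.tr s - P) hb₁.le
    (Filter.Eventually.of_forall fun n x => IFam.norm_avg_fn_le _ (fun n j x => hcb n (s n, j) x) n x)
  have h3 := mul_le_mul_of_nonneg_left (h' s hs) hD.le
  have h4 := mul_le_mul_of_nonneg_left (h s hs) hb₁.le
  have e3 : D * (κ / (2 * D)) = κ / 2 := by field_simp
  have e4 : b₁ * (κ / (2 * b₁)) = κ / 2 := by field_simp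
  linarith

variable (σ) in
/-- The factor of functions whose infinitesimal translates are, up to arbitrarily small errors,
averages of products of a fixed family in `B` with coefficients in `C`. -/
def apFactor (C B : S.Factor) : S.Factor where
  carrier := {F | ∀ κ > 0, σ.Represents C B F κ}
  algebraMap_mem' z κ hκ := by
    refine ⟨fun _ => Unit, inferInstance, inferInstance, IFam.const _ (algebraMap ℂ S.BF z),
      IFam.const _ 1, fun s hs j => C.algebraMap_mem z, fun j => B.one_mem, fun s hs => ?_⟩
    refine le_trans (le_of_eq ?_) hκ.le
    refine BF.norm_sub_eq_zero (Filter.Eventually.of_forall fun n x => ?_)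
    simp [BF.tr_algebraMap, IFam.mul, IFam.reindex, IFam.const]
  add_mem' hF hH κ hκ :=
    ((hF (κ / 2) (by positivity)).add (hH (κ / 2) (by positivity))).mono (fun _ h => h)
      (fun _ h => h) (by linarith)
  mul_mem' hF hH := Represents.mul hF hH
  star_mem' hF κ hκ := (hF κ hκ).star
  closed' F h κ hκ := by
    obtain ⟨P, hP, hFP⟩ := h (κ / 2) (by positivity)
    exact ((hP (κ / 2) (by positivity)).of_norm_sub_le hFP).mono (fun _ h => h)
      (fun _ h => h) (by linarith)
  tr_mem' t _ hF κ hκ := (hF κ hκ).tr t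

variable (σ) in
/-- The characteristic factors for the uniformity norms: `Z d` is the one for the norm of
degree `d + 1`. -/
def Z : ℕ → S.Factor
  | 0 => σ.invFactor
  | d + 1 => σ.apFactor (Z d) (Factor.top S)

/-- Stated for arbitrary `B` and `C`, since the argument is also run inside a given factor in
`mem_apFactor_of_mem`. -/
theorem dual_mem_apFactor {C B : S.Factor} (k d : ℕ) {F : S.BF} (hF : F ∈ B)
    (hC : ∀ H ∈ B, BF.dual (σ.q k) d H ∈ C) :
    BF.dual (σ.q k) (d + 1) F ∈ σ.apFactor C B := by
  intro κ hκ
  refine ⟨fun n => σ.J k n × σ.J k n, inferInstance, inferInstance, BF.coefFam (σ.q k) d F,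
    BF.shiftFam (σ.q k) F, fun s hs j => ?_, fun j => BF.shiftFam_at'_mem hF _ j,
    fun s hs => ?_⟩
  · rw [BF.coefFam_at']
    exact Factor.tr_mem _ (hC _ (BF.delta_mem hF _ _))
  · exact (norm_tr_dual_sub σ hs k d F).trans_le hκ.le

/-- In degree one the coefficients are the constant 1, so the represented translate is the dual
function itself, which is therefore invariant. Higher degrees follow by induction, since the
coefficients are dual functions of lower degree. -/
theorem dual_mem_Z (k d : ℕ) (F : S.BF) : BF.dual (σ.q k) (d + 1) F ∈ σ.Z d := by
  induction d generalizing F with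
  | zero =>
    intro s hs
    have h := norm_tr_dual_sub σ hs k 0 F
    rwa [show (((BF.coefFam (σ.q k) 0 F).reindex
      fun n (p : σ.J k n × σ.J k n) => (s n, p)).mul (BF.shiftFam (σ.q k) F)).avg =
        BF.dual (σ.q k) 1 F from ?_] at h
    rw [BF.dual_succ_eq]
    rfl
  | succ d ih => exact dual_mem_apFactor k (d + 1) (Factor.mem_top F) fun H _ => ih H

end Scale

/-! ### Weighted averages and orthogonality to the characteristic factors -/

namespace BF

variable {J : ℕ → Type} [∀ n, Fintype (J n)] [∀ n, Nonempty (J n)]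

/-- The average of the translates of `f` along `q`, with conjugated weights `c`. -/
def wavg (c : S.IFam J) (q : ∀ n, J n → S.G n) (f : S.BF) : S.BF :=
  (c.conj.mul ((IFam.const J f).trans q)).avg

theorem wavg_fn (c : S.IFam J) (q : ∀ n, J n → S.G n) (f : S.BF) (n x) :
    (wavg c q f).fn n x = 𝔼 j, (starRingEnd ℂ) (c.fn n j x) * f.fn n (-(q n j) +ᵥ x) := rfl

theorem integral_norm_sq_wavg (c : S.IFam J) (q : ∀ n, J n → S.G n) (f : S.BF) (n : ℕ) :
    ((∫ x, ‖(wavg c q f).fn n x‖ ^ 2 ∂S.μ n : ℝ) : ℂ) =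
      𝔼 p : J n × J n, ∫ x, (starRingEnd ℂ) (c.fn n p.1 x * (starRingEnd ℂ) (c.fn n p.2 x)) *
        multDeriv (q n p.1) (q n p.2) (f.fn n) x ∂S.μ n := by
  rw [← integral_star_mul_self, ← integral_expect]
  · refine integral_congr_ae (Filter.Eventually.of_forall fun x => ?_)
    simp only [mul_fn, star_fn, wavg_fn, star_expect, expect_prod, Finset.expect_mul_expect]
    rw [Finset.expect_comm (M := ℂ)]
    refine Finset.expect_congr rfl fun j _ => Finset.expect_congr rfl fun j' _ => ?_
    simp only [multDeriv, sysTranslate, map_mul, Complex.conj_conj]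
    ring
  · intro p
    exact (star (c.at' (Function.update (fun n => Classical.arbitrary _) n p.1) *
      star (c.at' (Function.update (fun n => Classical.arbitrary _) n p.2))) *
      delta (Function.update (fun n => 0) n (q n p.1)) (Function.update (fun n => 0) n (q n p.2))
        f).integrable n |>.congr (Filter.Eventually.of_forall fun x => by simp [delta_fn])

theorem memLp (f : S.BF) (n : ℕ) : MemLp (f.fn n) ⊤ (S.μ n) := by
  obtain ⟨C, -, hC⟩ := f.exists_bound
  exact memLp_top_of_bound (f.measurable n).aestronglyMeasurable C
    (Filter.Eventually.of_forall (hC n))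

theorem norm_eq_zero_of_tendsto {V : S.BF}
    (h : Tendsto (fun n => ∫ x, ‖V.fn n x‖ ^ 2 ∂S.μ n) limitFilter (𝓝 0)) : ‖V‖ = 0 := by
  have := tendsto_nhds_unique V.tendsto_norm_sq h
  simpa using this

/-- With trivial weights, the squared norm of the average is the Gowers average of degree one. -/
theorem norm_wavg_one {q : ∀ n, J n → S.G n} {f : S.BF}
    (hf : Tendsto (fun n => gowersAvg (S.μ n) (valueMultiset (q n)) 1 (f.fn n)) limitFilter
      (𝓝 0)) : ‖wavg (IFam.const J 1) q f‖ = 0 := by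
  refine norm_eq_zero_of_tendsto ?_
  have h : Tendsto (fun n => ((∫ x, ‖(wavg (IFam.const J 1) q f).fn n x‖ ^ 2 ∂S.μ n : ℝ) : ℂ))
      limitFilter (𝓝 0) := by
    refine hf.congr fun n => ?_
    rw [integral_norm_sq_wavg, gowersAvg_succ, expect_prod]
    simp [IFam.const, gowersAvg]
  exact_mod_cast (Complex.continuous_re.tendsto _).comp h

/-- The squared norm expands into an average over pairs of the correlation of a derivative of `f`
with a product of weights, an element of `C`. On average over pairs, the derivatives have vanishing
Gowers average of degree `d + 1`, and `hC` makes such correlations vanish;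
`tendsto_expect_of_tendsto` combines the two. -/
theorem norm_wavg_eq_zero {C : S.Factor} {q : ∀ n, J n → S.G n} {d : ℕ}
    (hC : ∀ f : S.BF, Tendsto (fun n => gowersAvg (S.μ n) (valueMultiset (q n)) (d + 1) (f.fn n))
      limitFilter (𝓝 0) → ∀ F ∈ C, inner ℂ F f = 0) {f : S.BF}
    (hf : Tendsto (fun n => gowersAvg (S.μ n) (valueMultiset (q n)) (d + 2) (f.fn n)) limitFilter
      (𝓝 0)) {c : S.IFam J} (hc : ∀ j, c.at' j ∈ C) : ‖wavg c q f‖ = 0 := by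
  refine norm_eq_zero_of_tendsto ?_
  obtain ⟨D, hD, hDc⟩ := c.bound
  obtain ⟨E, hE, hEf⟩ := f.exists_bound
  set v : ∀ n, J n × J n → ℝ := fun n p => ‖gowersAvg (S.μ n) (valueMultiset (q n)) (d + 1)
    (multDeriv (q n p.1) (q n p.2) (f.fn n))‖
  set I : ∀ n, J n × J n → ℂ := fun n p => ∫ x, (starRingEnd ℂ) (c.fn n p.1 x *
    (starRingEnd ℂ) (c.fn n p.2 x)) * multDeriv (q n p.1) (q n p.2) (f.fn n) x ∂S.μ n
  have hv : ∀ n p, gowersAvg (S.μ n) (valueMultiset (q n)) (d + 1)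
      (multDeriv (q n p.1) (q n p.2) (f.fn n)) = (v n p : ℂ) := by
    intro n p
    obtain ⟨a, ha, h⟩ := gowersAvg_nonneg (S.sys n) (valueMultiset (q n)) (d + 1) (by omega) _
      (memLp_multDeriv (S.sys n) (q n p.1) (q n p.2) (f.memLp n))
    simp only [v]
    rw [h, Complex.norm_real, Real.norm_of_nonneg ha]
  have key := tendsto_expect_of_tendsto v (fun n p => ‖I n p‖) (D * D * (E * E))
    (fun n p => norm_nonneg _) (fun n p => norm_nonneg _) (fun n p => ?_) (fun p hp => ?_) ?_
  · refine squeeze_zero (fun n => by positivity) (fun n => ?_) key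
    have h1 := integral_norm_sq_wavg c q f n
    have h2 : ∫ x, ‖(wavg c q f).fn n x‖ ^ 2 ∂S.μ n = ‖𝔼 p, I n p‖ := by
      rw [← h1, Complex.norm_real, Real.norm_of_nonneg (by positivity)]
    rw [h2]
    simp only [Fintype.expect_eq_sum_div_card, norm_div, RCLike.norm_natCast]
    gcongr
    exact norm_sum_le _ _
  · have := norm_integral_le_of_norm_le_const (μ := S.μ n) (C := D * D * (E * E))
      (f := fun x => (starRingEnd ℂ) (c.fn n p.1 x *
        (starRingEnd ℂ) (c.fn n p.2 x)) * multDeriv (q n p.1) (q n p.2) (f.fn n) x)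
      (Filter.Eventually.of_forall fun x => by
        rw [norm_mul, RCLike.norm_conj, norm_mul, RCLike.norm_conj]
        have h1 := norm_multDeriv_le (hEf n) (q n p.1) (q n p.2) x
        gcongr
        · exact hDc n _ x
        · exact hDc n _ x)
    exact this.trans (by simp)
  · have h0 := hC (delta (fun n => q n (p n).1) (fun n => q n (p n).2) f) (by
      refine tendsto_zero_iff_norm_tendsto_zero.2 ?_
      exact hp) (c.at' (fun n => (p n).1) * star (c.at' fun n => (p n).2))
      (Factor.mul_mem (hc _) (Factor.star_mem (hc _)))
    have h1 := (tendsto_inner (c.at' (fun n => (p n).1) * star (c.at' fun n => (p n).2))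
      (delta (fun n => q n (p n).1) (fun n => q n (p n).2) f)).norm
    rw [h0, norm_zero] at h1
    exact h1
  · have h1 : ∀ n, ((𝔼 p, v n p : ℝ) : ℂ) =
        gowersAvg (S.μ n) (valueMultiset (q n)) (d + 2) (f.fn n) := by
      intro n
      rw [gowersAvg_succ, ← expect_prod fun p : J n × J n => gowersAvg (S.μ n)
        (valueMultiset (q n)) (d + 1) (multDeriv (q n p.1) (q n p.2) (f.fn n))]
      simp only [hv, Fintype.expect_eq_sum_div_card]
      push_cast
      rfl
    have h2 := (Complex.continuous_re.tendsto _).comp (hf.congr fun n => (h1 n).symm)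
    exact_mod_cast h2

end BF

namespace Scale

variable {σ : S.Scale} {J : ℕ → Type} [∀ n, Fintype (J n)] [∀ n, Nonempty (J n)]

/-- Invariance of `F` gives all infinitesimal translates of `f` the same inner product with `F`, so
`f` may be replaced by their average. -/
theorem norm_inner_le_of_mem_invFactor {F : S.BF} (hF : F ∈ σ.invFactor) {q : ∀ n, J n → S.G n}
    (hq : ∀ j : ∀ n, J n, σ.Inf fun n => q n (j n)) (f : S.BF) :
    ‖inner ℂ F f‖ ≤ ‖inner ℂ F (BF.wavg (IFam.const J 1) q f)‖ := by
  have h0 : ∀ j : ∀ n, J n, inner ℂ F (f.tr fun n => q n (j n)) = inner ℂ F f := by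
    intro j
    rw [← BF.inner_tr (fun n => q n (j n)) F f, ← sub_eq_zero, ← inner_sub_left, ← neg_sub,
      inner_neg_left, BF.inner_eq_zero_of_norm_left (hF _ (hq j)), neg_zero]
  set c : S.IFam J := ⟨fun n j x => f.fn n (-(q n j) +ᵥ x) - f.fn n x,
    fun n j => ((f.measurable n).comp (S.measurable_vadd n _)).sub (f.measurable n), by
      obtain ⟨C, hC, h⟩ := f.exists_bound
      exact ⟨C + C, by positivity, fun n j x =>
        (norm_sub_le _ _).trans (add_le_add (h _ _) (h _ _))⟩⟩
  have h1 : c.avg = BF.wavg (IFam.const J 1) q f - f := by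
    ext n x
    simp [c, BF.wavg_fn, IFam.const, Finset.expect_sub_distrib]
  obtain ⟨j, hj⟩ := c.exists_norm_inner_avg_le F
  have h2 : c.at' j = f.tr (fun n => q n (j n)) - f := rfl
  rw [h1, h2, inner_sub_right, inner_sub_right, h0, sub_self, norm_zero] at hj
  rw [sub_eq_zero.1 (norm_le_zero_iff.1 hj)]

/-- The correlation of `F` and `f` is that of their translates by `s`. Insert the representation of
the translate of `F`, average over `s` and exchange the averages: for each `j` the fixed `g_j` is
paired with a weighted average of `f`. A single good `j` per stage suffices. -/
theorem exists_norm_inner_le_of_mem_apFactor {C B : S.Factor} {F : S.BF}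
    (hF : F ∈ σ.apFactor C B) {q : ∀ n, J n → S.G n}
    (hq : ∀ j : ∀ n, J n, σ.Inf fun n => q n (j n)) (f : S.BF) {κ : ℝ} (hκ : 0 < κ) :
    ∃ g ∈ B, ∃ c : S.IFam J, (∀ j, c.at' j ∈ C) ∧
      ‖inner ℂ F f‖ ≤ κ * ‖f‖ + ‖inner ℂ g (BF.wavg c q f)‖ := by
  obtain ⟨J', _, _, c, g, hc, hg, h⟩ := hF κ hκ
  set A : ∀ n, J n → ℂ := fun n s =>
    ∫ x, (starRingEnd ℂ) (𝔼 j, c.fn n (q n s, j) x * g.fn n j x) * f.fn n (-(q n s) +ᵥ x) ∂S.μ n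
  set A' : ∀ n, J' n → ℂ := fun n j =>
    ∫ x, (starRingEnd ℂ) (g.fn n j x) *
      (𝔼 s, (starRingEnd ℂ) (c.fn n (q n s, j) x) * f.fn n (-(q n s) +ᵥ x)) ∂S.μ n
  have hAA : ∀ n, 𝔼 s, A n s = 𝔼 j, A' n j := by
    intro n
    obtain ⟨D, hD, hDc⟩ := c.bound
    obtain ⟨D', hD', hDg⟩ := g.bound
    obtain ⟨E, hE, hEf⟩ := f.exists_bound
    have hint : ∀ s j, Integrable (fun x => (starRingEnd ℂ) (c.fn n (q n s, j) x * g.fn n j x) *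
        f.fn n (-(q n s) +ᵥ x)) (S.μ n) := by
      intro s j
      refine Integrable.of_bound (((Complex.continuous_conj.measurable.comp
        ((c.meas n _).mul (g.meas n j))).mul
        ((f.measurable n).comp (S.measurable_vadd n _))).aestronglyMeasurable) (D * D' * E)
        (Filter.Eventually.of_forall fun x => ?_)
      rw [norm_mul, RCLike.norm_conj, norm_mul]
      gcongr
      · exact hDc _ _ _
      · exact hDg _ _ _
      · exact hEf _ _
    have e1 : ∀ s, A n s = 𝔼 j, ∫ x, (starRingEnd ℂ) (c.fn n (q n s, j) x * g.fn n j x) *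
        f.fn n (-(q n s) +ᵥ x) ∂S.μ n := by
      intro s
      rw [← integral_expect fun j => hint s j]
      simp only [A, star_expect, Finset.expect_mul]
    have e2 : ∀ j, A' n j = 𝔼 s, ∫ x, (starRingEnd ℂ) (c.fn n (q n s, j) x * g.fn n j x) *
        f.fn n (-(q n s) +ᵥ x) ∂S.μ n := by
      intro j
      rw [← integral_expect fun s => hint s j]
      refine integral_congr_ae (Filter.Eventually.of_forall fun x => ?_)
      simp only [Finset.mul_expect, map_mul]
      refine Finset.expect_congr rfl fun s _ => ?_
      ring
    simp only [e1, e2]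
    rw [Finset.expect_comm (M := ℂ)]
  -- The approximation error is controlled only along sequences of infinitesimals, so a worst `s` is
  -- picked at each stage.
  choose s hs using fun n => exists_norm_expect_le fun s =>
    ∫ x, (starRingEnd ℂ) (F.fn n x) * f.fn n x ∂S.μ n - A n s
  choose j hj using fun n => exists_norm_expect_le (A' n)
  refine ⟨g.at' j, hg j, c.reindex fun n (s : J n) => (q n s, j n), fun s =>
    hc _ (hq s) j, ?_⟩
  set P := ((c.reindex fun n (j : J' n) => (q n (s n), j)).mul g).avg
  have h1 : ‖inner ℂ F f‖ ≤ ‖inner ℂ F f - inner ℂ P (f.tr fun n => q n (s n))‖ +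
      ‖inner ℂ (g.at' j) (BF.wavg (c.reindex fun n (s : J n) => (q n s, j n)) q f)‖ := by
    refine le_of_tendsto_of_tendsto' (BF.tendsto_inner F f).norm
      (((BF.tendsto_inner F f).sub (BF.tendsto_inner P (f.tr fun n => q n (s n)))).norm.add
        (BF.tendsto_inner (g.at' j) _).norm) fun n => ?_
    have h2 := hs n
    rw [Finset.expect_sub_distrib, Fintype.expect_const, hAA] at h2
    calc _ = ‖(∫ x, (starRingEnd ℂ) (F.fn n x) * f.fn n x ∂S.μ n - 𝔼 j, A' n j) +
        𝔼 j, A' n j‖ := by rw [sub_add_cancel]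
      _ ≤ _ := (norm_add_le _ _).trans (add_le_add h2 (hj n))
  refine h1.trans (add_le_add_left ?_ _)
  rw [← BF.inner_tr (fun n => q n (s n)) F f, ← inner_sub_left]
  refine (norm_inner_le_norm _ _).trans ?_
  rw [BF.norm_tr]
  exact mul_le_mul_of_nonneg_right (h _ (hq s)) (norm_nonneg _)

/-- A function with vanishing uniformity norm is orthogonal to the characteristic factor. -/
theorem inner_eq_zero_of_mem_Z {q : ∀ n, J n → S.G n}
    (hq : ∀ j : ∀ n, J n, σ.Inf fun n => q n (j n)) (d : ℕ) (f : S.BF)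
    (hf : Tendsto (fun n => gowersAvg (S.μ n) (valueMultiset (q n)) (d + 1) (f.fn n)) limitFilter
      (𝓝 0)) (F : S.BF) (hF : F ∈ σ.Z d) : inner ℂ F f = 0 := by
  induction d generalizing f F with
  | zero =>
    have h := norm_inner_le_of_mem_invFactor hF hq f
    rwa [BF.inner_eq_zero_of_norm_right (BF.norm_wavg_one hf), norm_zero, norm_le_zero_iff] at h
  | succ d ih =>
    rw [← norm_le_zero_iff]
    refine le_of_forall_pos_le_add fun κ hκ => ?_
    obtain ⟨g, -, c, hc, h⟩ := exists_norm_inner_le_of_mem_apFactor hF hq f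
      (κ := κ / (‖f‖ + 1)) (by positivity)
    rw [BF.inner_eq_zero_of_norm_right (BF.norm_wavg_eq_zero (fun f hf F hF => ih f hf F hF) hf hc),
      norm_zero, add_zero] at h
    refine h.trans ?_
    rw [zero_add, div_mul_eq_mul_div, div_le_iff₀ (by positivity)]
    nlinarith [norm_nonneg f]

/-- A function orthogonal to its dual functions at all scales has vanishing uniformity norm at
some infinitesimal scale. -/
theorem exists_scale_tendsto (σ : S.Scale) (d : ℕ) (R : S.BF)
    (h : ∀ k, inner ℂ (BF.dual (σ.q k) d R) R = 0) :
    ∃ κ : ℕ → ℕ, (∀ K, ∀ᶠ n in limitFilter, K ≤ κ n) ∧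
      Tendsto (fun n => gowersAvg (S.μ n) (valueMultiset (σ.q (κ n) n)) d (R.fn n)) limitFilter
        (𝓝 0) := by
  have h1 : ∀ k : ℕ, ∀ᶠ n in limitFilter,
      ‖gowersAvg (S.μ n) (valueMultiset (σ.q k n)) d (R.fn n)‖ ≤ 1 / ((k : ℝ) + 1) := by
    intro k
    have := (BF.tendsto_gowersAvg (σ.q k) d R).norm
    rw [h k, norm_zero] at this
    exact (this.eventually_lt_const (by positivity)).mono fun n hn => hn.le
  obtain ⟨κ, hκ⟩ := exists_diagonal _ h1
  refine ⟨κ, fun K => (hκ K).mono fun n hn => hn.1, ?_⟩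
  rw [tendsto_zero_iff_norm_tendsto_zero]
  refine (tendsto_order.2 ⟨fun a ha => Filter.Eventually.of_forall fun n =>
    ha.trans_le (norm_nonneg _), fun a ha => ?_⟩)
  obtain ⟨K, hK⟩ := exists_nat_one_div_lt ha
  filter_upwards [hκ K] with n hn
  refine (hn.2.trans ?_).trans_lt hK
  have : (K : ℝ) ≤ κ n := by exact_mod_cast hn.1
  gcongr

theorem inf_of_scale (σ : S.Scale) {κ : ℕ → ℕ} (hκ : ∀ K, ∀ᶠ n in limitFilter, K ≤ κ n)
    (j : ∀ n, σ.J (κ n) n) : σ.Inf fun n => σ.q (κ n) n (j n) := by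
  intro k
  filter_upwards [hκ k] with n hn
  exact σ.anti k (κ n) n hn ⟨_, rfl⟩

/-- Orthogonality to one's own dual functions is thus enough for orthogonality to all of `Z d`. This
is what allows projections to smaller factors below. -/
theorem inner_eq_zero_of_dual (d : ℕ) (R : S.BF)
    (h : ∀ k, inner ℂ (BF.dual (σ.q k) (d + 1) R) R = 0) (F : S.BF) (hF : F ∈ σ.Z d) :
    inner ℂ F R = 0 := by
  obtain ⟨κ, hκ, hR⟩ := σ.exists_scale_tendsto (d + 1) R h
  exact inner_eq_zero_of_mem_Z (q := fun n => σ.q (κ n) n) (σ.inf_of_scale hκ) d R hR F hF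

/-- Projecting to `B ∩ Z d` already gives the projection to `Z d`: the remainder lies in `B`, hence
so do its dual functions, which are also in `Z d`. -/
theorem exists_proj_mem (B : S.Factor) (d : ℕ) {F : S.BF} (hF : F ∈ B) :
    ∃ P, P ∈ B ∧ P ∈ σ.Z d ∧ ∀ H ∈ σ.Z d, inner ℂ H (F - P) = 0 := by
  obtain ⟨P, hP, hR⟩ := (B.inf (σ.Z d)).exists_proj F
  exact ⟨P, hP.1, hP.2, inner_eq_zero_of_dual d _ fun k =>
    hR _ ⟨BF.dual_mem _ _ (Factor.sub_mem hF hP.1), dual_mem_Z k d _⟩⟩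

theorem mem_of_norm_self {B : S.Factor} {F P : S.BF} (hP : P ∈ B)
    (h : inner ℂ (F - P) (F - P) = (0 : ℂ)) : F ∈ B := by
  refine Factor.mem_of_norm_sub hP ?_
  rw [inner_self_eq_norm_sq_to_K] at h
  have h2 : ((‖F - P‖ : ℝ) : ℂ) ^ 2 = 0 := h
  exact_mod_cast pow_eq_zero_iff two_ne_zero |>.1 h2

/-- For elements of `B` the representation can be carried out within `B`. The remainder after
projecting to the relative factor is orthogonal to its own dual functions, which belong to that
factor, hence to all of `Z (d + 1)`, in which it lies. -/
theorem mem_apFactor_of_mem {B : S.Factor} {d : ℕ} {F : S.BF} (hF : F ∈ B)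
    (hFZ : F ∈ σ.Z (d + 1)) : F ∈ σ.apFactor (B.inf (σ.Z d)) B := by
  obtain ⟨P, hP, hR⟩ := (B.inf (σ.apFactor (B.inf (σ.Z d)) B)).exists_proj F
  have hle : ∀ H, H ∈ σ.apFactor (B.inf (σ.Z d)) B → H ∈ σ.Z (d + 1) := fun H hH κ hκ =>
    (hH κ hκ).mono (fun _ h => h.2) (fun H _ => Factor.mem_top H) le_rfl
  refine mem_of_norm_self hP.2 (inner_eq_zero_of_dual (d + 1) _ (fun k => hR _ ⟨?_, ?_⟩) _
    (Factor.sub_mem hFZ (hle _ hP.2)))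
  · exact BF.dual_mem _ _ (Factor.sub_mem hF hP.1)
  · exact dual_mem_apFactor k (d + 1) (Factor.sub_mem hF hP.1) fun H hH =>
      ⟨BF.dual_mem _ _ hH, dual_mem_Z k d H⟩

end Scale

end SysSeq

/-! ### Concatenation of two scales -/

namespace SysSeq

variable {S : SysSeq.{u, v}}

namespace Scale

/-- The scale of sums of elements of two scales. -/
def sum (σ τ : S.Scale) : S.Scale where
  J k n := σ.J k n × τ.J k n
  q k n p := σ.q k n p.1 + τ.q k n p.2
  anti := by
    rintro k l n hkl _ ⟨p, rfl⟩
    obtain ⟨i, hi⟩ := σ.anti k l n hkl ⟨p.1, rfl⟩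
    obtain ⟨j, hj⟩ := τ.anti k l n hkl ⟨p.2, rfl⟩
    exact ⟨(i, j), by simp only [hi, hj]⟩
  inv := by
    intro k η hη
    obtain ⟨l₁, h₁⟩ := σ.inv k (η / 2) (by positivity)
    obtain ⟨l₂, h₂⟩ := τ.inv k (η / 2) (by positivity)
    refine ⟨max l₁ l₂, fun n p φ hφ => ?_⟩
    obtain ⟨i, hi⟩ := σ.anti l₁ _ n (le_max_left l₁ l₂) ⟨p.1, rfl⟩
    obtain ⟨j, hj⟩ := τ.anti l₂ _ n (le_max_right l₁ l₂) ⟨p.2, rfl⟩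
    simp only [expect_prod, ← hi, ← hj]
    have e1 : ‖𝔼 a, 𝔼 b, φ (σ.q k n a + τ.q k n b + (σ.q l₁ n i + τ.q l₂ n j)) -
        𝔼 a, 𝔼 b, φ (σ.q k n a + σ.q l₁ n i + τ.q k n b)‖ ≤ η / 2 := by
      refine norm_expect_sub_le fun a => ?_
      have := h₂ n j (fun g => φ (σ.q k n a + σ.q l₁ n i + g)) fun g => hφ _
      refine le_trans (le_of_eq ?_) this
      congr 2
      refine Finset.expect_congr (M := ℂ) rfl fun b _ => ?_
      congr 1
      abel
    have e2 : ‖𝔼 a, 𝔼 b, φ (σ.q k n a + σ.q l₁ n i + τ.q k n b) -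
        𝔼 a, 𝔼 b, φ (σ.q k n a + τ.q k n b)‖ ≤ η / 2 := by
      rw [Finset.expect_comm (M := ℂ)]
      conv_lhs => enter [1, 2]; rw [Finset.expect_comm (M := ℂ)]
      exact norm_expect_sub_le fun b => h₁ n i (fun g => φ (g + τ.q k n b)) fun g => hφ _
    refine (norm_sub_le_norm_sub_add_norm_sub _ _ _).trans ((add_le_add e1 e2).trans ?_)
    linarith

theorem Inf.sum {σ τ : S.Scale} {s t : ∀ n, S.G n} (hs : σ.Inf s) (ht : τ.Inf t) :
    (σ.sum τ).Inf fun n => s n + t n := by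
  intro k
  filter_upwards [hs k, ht k] with n ⟨i, hi⟩ ⟨j, hj⟩
  exact ⟨(i, j), by simp only [Scale.sum, hi, hj]⟩

section

variable {σ : S.Scale} {J J' : ℕ → Type} [∀ n, Fintype (J n)] [∀ n, Nonempty (J n)]
  [∀ n, Fintype (J' n)] [∀ n, Nonempty (J' n)]

/-- Treats both kinds of factor at once: in degree zero the weights are 1 and `g` is `F`. Otherwise
the representation is taken inside `B ∩ Z d`, so that `g` keeps both memberships and the argument
can be repeated with a second scale. -/
theorem exists_norm_inner_le {B C : S.Factor} {d : ℕ} {F : S.BF} (hF : F ∈ B) (hFZ : F ∈ σ.Z d)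
    (hC : ∀ d', d = d' + 1 → ∀ H ∈ B, H ∈ σ.Z d' → H ∈ C) {q : ∀ n, J n → S.G n}
    (hq : ∀ j : ∀ n, J n, σ.Inf fun n => q n (j n)) (f : S.BF) {κ : ℝ} (hκ : 0 < κ) :
    ∃ g ∈ B, g ∈ σ.Z d ∧ ∃ c : S.IFam J, (∀ j, c.at' j ∈ C) ∧
      ‖inner ℂ F f‖ ≤ κ * ‖f‖ + ‖inner ℂ g (BF.wavg c q f)‖ := by
  cases d with
  | zero =>
    refine ⟨F, hF, hFZ, IFam.const J 1, fun j => C.one_mem, ?_⟩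
    have := norm_inner_le_of_mem_invFactor hFZ hq f
    nlinarith [norm_nonneg f]
  | succ d =>
    have h := mem_apFactor_of_mem (B := B.inf (σ.Z (d + 1))) ⟨hF, hFZ⟩ hFZ
    obtain ⟨g, hg, c, hc, h⟩ := exists_norm_inner_le_of_mem_apFactor h hq f hκ
    exact ⟨g, hg.1, hg.2, c, fun j => hC d rfl _ (hc j).1.1 (hc j).2, h⟩

theorem wavg_wavg (c : S.IFam J) (c' : S.IFam J') (q : ∀ n, J n → S.G n) (q' : ∀ n, J' n → S.G n)
    (f : S.BF) : BF.wavg c' q' (BF.wavg c q f) =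
      BF.wavg (J := fun n => J n × J' n)
        ((c'.reindex fun n (p : J n × J' n) => p.2).mul
          ((c.reindex fun n (p : J n × J' n) => p.1).trans fun n p => q' n p.2))
        (fun n p => q n p.1 + q' n p.2) f := by
  ext n x
  simp only [BF.wavg_fn, expect_prod, IFam.mul, IFam.reindex, IFam.trans, Finset.mul_expect]
  rw [Finset.expect_comm (M := ℂ)]
  refine Finset.expect_congr rfl fun j _ => Finset.expect_congr rfl fun j' _ => ?_
  rw [map_mul, vadd_vadd, neg_add]
  ring

end

/-- Concatenation: the characteristic factors for two scales of degrees `a + 1` and `b + 1`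
intersect inside the characteristic factor of degree `a + b + 1` of the sum scale. -/
theorem mem_Z_sum {σ τ : S.Scale} (N : ℕ) : ∀ (a b : ℕ), a + b = N → ∀ F : S.BF, F ∈ σ.Z a →
    F ∈ τ.Z b → F ∈ (σ.sum τ).Z N := by
  induction N with
  | zero =>
    intro a b hab F ha hb
    obtain ⟨rfl, rfl⟩ : a = 0 ∧ b = 0 := by omega
    obtain ⟨P, hP, hR⟩ := ((σ.sum τ).Z 0).exists_proj F
    refine mem_of_norm_self hP ?_
    rw [inner_sub_left, hR P hP, sub_zero]
    -- The error of the projection is orthogonal to its own dual functions, so its Gowers average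
    -- vanishes along an infinitesimal scale of sums. Averaging over both summands in turn will show
    -- that `F` does not correlate with it.
    obtain ⟨κ, hκ, hgow⟩ := (σ.sum τ).exists_scale_tendsto 1 (F - P) fun k =>
      hR _ (dual_mem_Z k 0 _)
    have h1 := norm_inner_le_of_mem_invFactor ha (σ.inf_of_scale hκ) (F - P)
    have h2 := norm_inner_le_of_mem_invFactor hb (τ.inf_of_scale hκ)
      (BF.wavg (IFam.const _ 1) (fun n => σ.q (κ n) n) (F - P))
    rw [wavg_wavg] at h2
    have h3 := BF.norm_wavg_one hgow
    have h4 := h1.trans h2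
    refine norm_le_zero_iff.1 (h4.trans (le_of_eq ?_))
    rw [norm_eq_zero]
    refine BF.inner_eq_zero_of_norm_right (Eq.trans ?_ h3) F
    congr 1
    ext n x
    change Finset.expect Finset.univ _ = Finset.expect Finset.univ _
    refine Finset.expect_congr (M := ℂ) rfl fun p _ => ?_
    simp [IFam.mul, IFam.reindex, IFam.trans, IFam.const, IFam.conj, Scale.sum]
  | succ N ih =>
    intro a b hab F ha hb
    obtain ⟨P, hP, hR⟩ := ((σ.sum τ).Z (N + 1)).exists_proj F
    refine mem_of_norm_self hP ?_
    rw [inner_sub_left, hR P hP, sub_zero]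
    obtain ⟨κ, hκ, hgow⟩ := (σ.sum τ).exists_scale_tendsto (N + 2) (F - P) fun k =>
      hR _ (dual_mem_Z k (N + 1) _)
    set R := F - P
    rw [← norm_le_zero_iff]
    refine le_of_forall_pos_le_add fun δ hδ => ?_
    rw [zero_add]
    -- The coefficients lie in `τ.Z b` and in a factor of `σ` of degree one less, so induction puts
    -- them in `(σ.sum τ).Z N`. The next application exchanges the roles of the scales.
    obtain ⟨g, hgB, hgZ, c, hc, h1⟩ := exists_norm_inner_le (B := τ.Z b) (C := (σ.sum τ).Z N)
      hb ha (fun a' ha' H hH1 hH2 => ih a' b (by omega) H hH2 hH1) (σ.inf_of_scale hκ) R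
      (κ := δ / 2 / (‖R‖ + 1)) (by positivity)
    set R₁ := BF.wavg c (fun n => σ.q (κ n) n) R
    obtain ⟨g', hgB', hgZ', c', hc', h2⟩ := exists_norm_inner_le (B := σ.Z a)
      (C := (σ.sum τ).Z N) hgZ hgB (fun b' hb' H hH1 hH2 => ih a b' (by omega) H hH1 hH2)
      (τ.inf_of_scale hκ) R₁ (κ := δ / 2 / (‖R₁‖ + 1)) (by positivity)
    -- The two averages compose to one along the sum scale with weights in `(σ.sum τ).Z N`; it
    -- vanishes because the degree `N + 2` average of `R` does.
    have h3 : ‖BF.wavg c' (fun n => τ.q (κ n) n) R₁‖ = 0 := by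
      rw [wavg_wavg]
      exact BF.norm_wavg_eq_zero (C := (σ.sum τ).Z N)
        (fun f hf H hH => inner_eq_zero_of_mem_Z (σ := σ.sum τ)
          (q := fun n => (σ.sum τ).q (κ n) n) ((σ.sum τ).inf_of_scale hκ) N f hf H hH) hgow
        fun j => Factor.mul_mem (hc' _) (Factor.tr_mem _ (hc _))
    rw [BF.inner_eq_zero_of_norm_right h3, norm_zero, add_zero] at h2
    have e : ∀ x : ℝ, 0 ≤ x → δ / 2 / (x + 1) * x ≤ δ / 2 := by
      intro x hx
      rw [div_mul_eq_mul_div, div_le_iff₀ (by positivity)]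
      nlinarith
    linarith [e _ (norm_nonneg R), e _ (norm_nonneg R₁)]

/-! ### Orthogonality of projections and the limiting Bessel inequality -/

/-- The orthogonality at the heart of the Bessel inequality. -/
theorem inner_proj_eq_zero {σ τ : S.Scale} {D : ℕ} {f P Q : S.BF} (hP : P ∈ σ.Z D)
    (hPf : ∀ H ∈ σ.Z D, inner ℂ H (f - P) = 0) (hQ : Q ∈ τ.Z D)
    {J : ℕ → Type} [∀ n, Fintype (J n)] [∀ n, Nonempty (J n)] {q : ∀ n, J n → S.G n}
    (hq : ∀ j : ∀ n, J n, (σ.sum τ).Inf fun n => q n (j n))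
    (hf : Tendsto (fun n => gowersAvg (S.μ n) (valueMultiset (q n)) (D + D + 1) (f.fn n))
      limitFilter (𝓝 0)) : inner ℂ Q P = 0 := by
  -- Projecting `Q` to `σ.Z D` does not leave `τ.Z D`, and neither this nor replacing `P` by `f`
  -- changes the inner product; concatenation then applies to `Q'`.
  obtain ⟨Q', hQ'τ, hQ'σ, hQ'⟩ := exists_proj_mem (σ := σ) (τ.Z D) D hQ
  have h1 : inner ℂ Q P = inner ℂ Q' P := by
    rw [← sub_eq_zero, ← inner_sub_left, ← inner_conj_symm, hQ' P hP, map_zero]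
  have h2 : inner ℂ Q' P = inner ℂ Q' f := by
    have := hPf Q' hQ'σ
    rw [inner_sub_right] at this
    exact (sub_eq_zero.1 this).symm
  rw [h1, h2]
  exact inner_eq_zero_of_mem_Z hq (D + D) f hf Q' (mem_Z_sum _ D D rfl _ hQ'σ hQ'τ)

/-- Bessel's inequality for the uniformity norms of a fixed finite number of scales. -/
theorem sum_norm_sq_le {m D : ℕ} (σ : Fin m → S.Scale) (f : S.BF) (hf1 : ∀ n x, ‖f.fn n x‖ ≤ 1)
    {J : Fin m → Fin m → ℕ → Type} [∀ a b n, Fintype (J a b n)] [∀ a b n, Nonempty (J a b n)]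
    (q : ∀ a b n, J a b n → S.G n)
    (hq : ∀ a b, ∀ j : ∀ n, J a b n, ((σ a).sum (σ b)).Inf fun n => q a b n (j n))
    (hf : ∀ a b, a ≠ b → Tendsto (fun n => gowersAvg (S.μ n) (valueMultiset (q a b n)) (D + D + 1)
      (f.fn n)) limitFilter (𝓝 0)) :
    ∑ a, ‖inner ℂ (BF.dual ((σ a).q 0) (D + 1) f) f‖ ^ 2 ≤ 1 := by
  choose P hP hPf using fun a => ((σ a).Z D).exists_proj f
  have hnf : ‖f‖ ≤ 1 := BF.norm_le_of_bound zero_le_one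
    (Filter.Eventually.of_forall fun n x => hf1 n x)
  have h1 : ∀ a, ‖inner ℂ (BF.dual ((σ a).q 0) (D + 1) f) f‖ ≤ ‖P a‖ := by
    intro a
    have h := hPf a _ (dual_mem_Z (σ := σ a) 0 D f)
    rw [inner_sub_right, sub_eq_zero] at h
    rw [h]
    refine (norm_inner_le_norm _ _).trans (mul_le_of_le_one_left (norm_nonneg _) ?_)
    refine BF.norm_le_of_bound zero_le_one (Filter.Eventually.of_forall fun n x => ?_)
    rw [← dualBound_one (D + 1)]
    exact norm_dualFn_le _ _ zero_le_one (hf1 n) x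
  have horth : ∀ a b, a ≠ b → inner ℂ (P b) (P a) = 0 := fun a b hab =>
    inner_proj_eq_zero (hP a) (hPf a) (hP b) (hq a b) (hf a b hab)
  have h2 : ∀ a, inner ℂ (P a) f = ((‖P a‖ ^ 2 : ℝ) : ℂ) := by
    intro a
    have := hPf a _ (hP a)
    rw [inner_sub_right, sub_eq_zero, inner_self_eq_norm_sq_to_K] at this
    rw [this]
    norm_cast
  have h3 : ‖∑ a, P a‖ ^ 2 = ∑ a, ‖P a‖ ^ 2 := by
    have : inner ℂ (∑ a, P a) (∑ a, P a) = ((∑ a, ‖P a‖ ^ 2 : ℝ) : ℂ) := by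
      rw [sum_inner]
      push_cast
      refine Finset.sum_congr rfl fun a _ => ?_
      rw [inner_sum, Finset.sum_eq_single a, inner_self_eq_norm_sq_to_K]
      · norm_cast
      · exact fun b _ hb => horth b a hb
      · simp
    rw [inner_self_eq_norm_sq_to_K] at this
    exact_mod_cast (show ((‖∑ a, P a‖ : ℝ) : ℂ) ^ 2 = ((∑ a, ‖P a‖ ^ 2 : ℝ) : ℂ) from this)
  -- Bessel: the squared distance from `f` to the sum of the projections is `‖f‖ ^ 2` minus the sum
  -- of their squared norms.
  have h4 := @norm_sub_sq ℂ _ _ _ _ f (∑ a, P a)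
  have h5 : RCLike.re (inner ℂ f (∑ a, P a)) = ∑ a, ‖P a‖ ^ 2 := by
    rw [← inner_conj_symm, RCLike.conj_re, sum_inner]
    simp only [h2]
    rw [← Complex.ofReal_sum]
    exact Complex.ofReal_re _
  rw [h3, h5] at h4
  have h6 : ∑ a, ‖inner ℂ (BF.dual ((σ a).q 0) (D + 1) f) f‖ ^ 2 ≤ ∑ a, ‖P a‖ ^ 2 :=
    Finset.sum_le_sum fun a _ => pow_le_pow_left₀ (norm_nonneg _) (h1 a) 2
  nlinarith [sq_nonneg ‖f - ∑ a, P a‖, norm_nonneg f]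

end Scale

end SysSeq

/-! ### Almost invariance of averages over coset progressions -/

theorem card_filter_shift_le (M m : ℤ) :
    ((Finset.Icc (-M) M).filter fun x => x - m ∉ Finset.Icc (-M) M).card ≤ m.natAbs := by
  rcases le_total 0 m with h | h
  · have hsub : ((Finset.Icc (-M) M).filter fun x => x - m ∉ Finset.Icc (-M) M) ⊆
        Finset.Ico (-M) (-M + m) := by
      intro x hx
      simp only [Finset.mem_filter, Finset.mem_Icc, Finset.mem_Ico] at hx ⊢
      omega
    refine (Finset.card_le_card hsub).trans ?_
    rw [Int.card_Ico]
    omega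
  · have hsub : ((Finset.Icc (-M) M).filter fun x => x - m ∉ Finset.Icc (-M) M) ⊆
        Finset.Ioc (M + m) M := by
      intro x hx
      simp only [Finset.mem_filter, Finset.mem_Icc, Finset.mem_Ioc] at hx ⊢
      omega
    refine (Finset.card_le_card hsub).trans ?_
    rw [Int.card_Ioc]
    omega

section Box

variable {r : ℕ} (N : Fin r → ℝ)

theorem integerBox_nonempty (hN : ∀ i, 0 < N i) : (integerBox N).Nonempty :=
  ⟨0, (mem_integerBox N 0).2 fun i => by simpa using (hN i).le⟩

/-- Only one coordinate is constrained, so the set is a product and the ratio is that of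
one-dimensional counts. The side has at least `N i` points, even when `N i < 1`. -/
theorem card_box_filter_le (hN : ∀ i, 0 < N i) (m : Fin r → ℤ) {t : ℝ}
    (hm : ∀ i, |(m i : ℝ)| ≤ t * N i) (i : Fin r) :
    (((integerBox N).filter fun n => n i - m i ∉ Finset.Icc (-⌊N i⌋) ⌊N i⌋).card : ℝ) ≤
      t * (integerBox N).card := by
  classical
  set S : Fin r → Finset ℤ := fun i => Finset.Icc (-⌊N i⌋) ⌊N i⌋
  set T : Finset ℤ := (S i).filter fun x => x - m i ∉ S i
  have hset : ((integerBox N).filter fun n => n i - m i ∉ Finset.Icc (-⌊N i⌋) ⌊N i⌋) =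
      Fintype.piFinset (Function.update S i T) := by
    ext n
    simp only [integerBox, Finset.mem_filter, Fintype.mem_piFinset]
    constructor
    · rintro ⟨h1, h2⟩ j
      by_cases hj : j = i
      · subst hj
        rw [Function.update_self]
        exact Finset.mem_filter.2 ⟨h1 j, h2⟩
      · rw [Function.update_of_ne hj]
        exact h1 j
    · intro h
      have hi := h i
      rw [Function.update_self] at hi
      refine ⟨fun j => ?_, (Finset.mem_filter.1 hi).2⟩
      by_cases hj : j = i
      · subst hj
        exact (Finset.mem_filter.1 hi).1
      · have := h j
        rwa [Function.update_of_ne hj] at this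
  have hcard1 : (Fintype.piFinset (Function.update S i T)).card =
      T.card * ∏ j ∈ Finset.univ \ {i}, (S j).card := by
    rw [Fintype.card_piFinset, ← Finset.prod_update_of_mem (Finset.mem_univ i)]
    refine Finset.prod_congr rfl fun j _ => ?_
    by_cases hj : j = i
    · subst hj; simp
    · simp [Function.update_of_ne hj]
  have hcard2 : (integerBox N).card = (S i).card * ∏ j ∈ Finset.univ \ {i}, (S j).card := by
    rw [integerBox, Fintype.card_piFinset, ← Finset.prod_update_of_mem (Finset.mem_univ i),
      Function.update_eq_self]
  have hT : (T.card : ℝ) ≤ t * (S i).card := by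
    have h1 : (T.card : ℝ) ≤ |(m i : ℝ)| := by
      rw [← Int.cast_abs, Int.abs_eq_natAbs]
      exact_mod_cast card_filter_shift_le ⌊N i⌋ (m i)
    have h2 : N i ≤ (S i).card := by
      have h3 : 0 ≤ ⌊N i⌋ := Int.floor_nonneg.2 (hN i).le
      have h4 : ((S i).card : ℤ) = 2 * ⌊N i⌋ + 1 := by
        simp only [S, Int.card_Icc]
        omega
      have h5 : ((S i).card : ℝ) = 2 * (⌊N i⌋ : ℝ) + 1 := by exact_mod_cast h4
      have h6 : (0 : ℝ) ≤ ⌊N i⌋ := by exact_mod_cast h3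
      rw [h5]
      linarith [Int.lt_floor_add_one (N i)]
    have ht : 0 ≤ t := by
      have := (abs_nonneg _).trans (hm i)
      exact nonneg_of_mul_nonneg_left this (hN i)
    exact h1.trans ((hm i).trans (mul_le_mul_of_nonneg_left h2 ht))
  rw [hset, hcard1, hcard2]
  push_cast
  rw [← mul_assoc]
  exact mul_le_mul_of_nonneg_right hT (Finset.prod_nonneg fun j _ => by positivity)

/-- The shifted and original boxes differ in two sets of equal size. A point of the difference
leaves the box in some coordinate, and the union bound gives the factor `r`. -/
theorem norm_expect_box_shift_le (hN : ∀ i, 0 < N i) (m : Fin r → ℤ) {t : ℝ}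
    (hm : ∀ i, |(m i : ℝ)| ≤ t * N i) (ψ : (Fin r → ℤ) → ℂ) (hψ : ∀ n, ‖ψ n‖ ≤ 1) :
    ‖𝔼 n ∈ integerBox N, ψ (n + m) - 𝔼 n ∈ integerBox N, ψ n‖ ≤ 2 * (r * t) := by
  classical
  set B := integerBox N
  set B' := B.map (addRightEmbedding m)
  have hBne : (0 : ℝ) < B.card := by exact_mod_cast (integerBox_nonempty N hN).card_pos
  have h1 : ∑ n ∈ B, ψ (n + m) = ∑ n ∈ B', ψ n := by simp [B', addRightEmbedding]
  have h2 : ∑ n ∈ B', ψ n - ∑ n ∈ B, ψ n = ∑ n ∈ B' \ B, ψ n - ∑ n ∈ B \ B', ψ n := by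
    rw [← Finset.sum_inter_add_sum_sdiff B' B, ← Finset.sum_inter_add_sum_sdiff B B',
      Finset.inter_comm]
    ring
  have hcard : (B' \ B).card = (B \ B').card := Finset.card_sdiff_comm (by simp [B'])
  have h3 : ((B \ B').card : ℝ) ≤ r * t * B.card := by
    have hsub : B \ B' ⊆ Finset.univ.biUnion fun i =>
        B.filter fun n => n i - m i ∉ Finset.Icc (-⌊N i⌋) ⌊N i⌋ := by
      intro n hn
      rw [Finset.mem_sdiff] at hn
      by_contra hcon
      apply hn.2
      simp only [Finset.mem_biUnion, Finset.mem_univ, true_and, Finset.mem_filter, not_exists,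
        not_and, not_not] at hcon
      refine Finset.mem_map.2 ⟨n - m, ?_, by simp [addRightEmbedding]⟩
      exact Fintype.mem_piFinset.2 fun i => hcon i hn.1
    have h4 : ((B \ B').card : ℝ) ≤ ∑ i : Fin r,
        ((B.filter fun n => n i - m i ∉ Finset.Icc (-⌊N i⌋) ⌊N i⌋).card : ℝ) := by
      exact_mod_cast (Finset.card_le_card hsub).trans Finset.card_biUnion_le
    refine h4.trans ((Finset.sum_le_sum fun i _ => card_box_filter_le N hN m hm i).trans ?_)
    simp [mul_assoc, B]
  have h5 : ∀ s : Finset (Fin r → ℤ), ‖∑ n ∈ s, ψ n‖ ≤ s.card := fun s =>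
    (norm_sum_le _ _).trans ((Finset.sum_le_sum fun n _ => hψ n).trans (by simp))
  rw [Finset.expect_eq_sum_div_card, Finset.expect_eq_sum_div_card, ← sub_div, h1, h2, norm_div,
    RCLike.norm_natCast, div_le_iff₀ hBne]
  refine (norm_sub_le _ _).trans ((add_le_add (h5 _) (h5 _)).trans ?_)
  rw [hcard]
  linarith

end Box

section MultisetAvg

variable {G : Type*}

theorem multisetAvg_sumset [Add G] (A B : Multiset G) (F : G → ℂ) :
    multisetAvg (multisetSumset A B) F =
      multisetAvg A fun a => multisetAvg B fun b => F (a + b) := by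
  have h : ∀ A : Multiset G, ((A ×ˢ B).map fun p => F (p.1 + p.2)).sum =
      (A.map fun a => (B.map fun b => F (a + b)).sum).sum := by
    intro A
    induction A using Multiset.induction with
    | empty => simp
    | cons a A ih => simp [Multiset.cons_product, ih, Multiset.map_map]
  simp only [multisetAvg, multisetSumset, Multiset.map_map, Function.comp_def, h,
    Multiset.card_map, Multiset.card_product, Multiset.sum_map_div]
  push_cast
  rw [div_div, mul_comm]

theorem multisetAvg_nsmul {m : ℕ} (hm : 0 < m) (A : Multiset G) (F : G → ℂ) :
    multisetAvg (m • A) F = multisetAvg A F := by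
  have : (m : ℂ) ≠ 0 := by exact_mod_cast hm.ne'
  simp only [multisetAvg, Multiset.map_nsmul, Multiset.sum_nsmul, Multiset.card_nsmul,
    nsmul_eq_mul]
  push_cast
  exact mul_div_mul_left _ _ this

theorem multisetAvg_finset_map {ι : Type*} (s : Finset ι) (f : ι → G) (F : G → ℂ) :
    multisetAvg (s.val.map f) F = 𝔼 i ∈ s, F (f i) := by
  rw [multisetAvg, Multiset.map_map, Finset.expect_eq_sum_div_card, Multiset.card_map]
  rfl

theorem exists_valueMultiset_eq (A : Multiset G) (hA : A ≠ 0) :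
    ∃ (m : ℕ) (q : Fin (m + 1) → G), valueMultiset q = A := by
  obtain ⟨l, rfl⟩ := Quot.exists_rep A
  cases l with
  | nil => exact absurd rfl hA
  | cons a l =>
    refine ⟨l.length, (a :: l).get, ?_⟩
    simp [valueMultiset, Fin.univ_val_map]

theorem mem_valueMultiset {J : Type*} [Fintype J] (q : J → G) (g : G) :
    g ∈ valueMultiset q ↔ g ∈ Set.range q := by
  simp [valueMultiset]

theorem multisetSumset_valueMultiset [Add G] {J J' : Type*} [Fintype J] [Fintype J'] (q : J → G)
    (q' : J' → G) : multisetSumset (valueMultiset q) (valueMultiset q') =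
      valueMultiset fun p : J × J' => q p.1 + q' p.2 := by
  have h : ∀ (A : Multiset J) (B : Multiset J'), multisetSumset (A.map q) (B.map q') =
      (A ×ˢ B).map fun p => q p.1 + q' p.2 := by
    intro A B
    induction A using Multiset.induction with
    | empty => simp [multisetSumset]
    | cons a A ih =>
      simp only [multisetSumset] at ih
      simp [multisetSumset, Multiset.cons_product, ih, Multiset.map_map]
  exact h _ _

end MultisetAvg

namespace CosetProgression

variable {G : Type*} [AddCommGroup G] (Q : CosetProgression G)

theorem mem_toMultiset (g : G) : g ∈ Q.toMultiset ↔
    ∃ h ∈ Q.H, ∃ n : Fin Q.rank → ℤ, (∀ i, |(n i : ℝ)| ≤ Q.N i) ∧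
      h + ∑ i, n i • Q.v i = g := by
  simp only [toMultiset, multisetSumset, Multiset.mem_map, Multiset.mem_product,
    Multiset.mem_nsmul_of_ne_zero Q.mult_pos.ne', Finset.mem_val, Set.Finite.mem_toFinset,
    SetLike.mem_coe, Prod.exists]
  constructor
  · rintro ⟨h, _, ⟨hh, n, hn, rfl⟩, rfl⟩
    exact ⟨h, hh, n, (mem_integerBox _ _).1 hn, rfl⟩
  · rintro ⟨h, hh, n, hn, rfl⟩
    exact ⟨h, _, ⟨hh, n, (mem_integerBox _ _).2 hn, rfl⟩, rfl⟩

theorem toMultiset_ne_zero : Q.toMultiset ≠ 0 := by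
  intro h
  have : (0 : G) ∈ Q.toMultiset := (Q.mem_toMultiset 0).2
    ⟨0, Q.H.zero_mem, 0, fun i => by simpa using (Q.N_pos i).le, by simp⟩
  rw [h] at this
  exact Multiset.notMem_zero _ this

theorem toMultiset_dilate_one : (Q.dilate 1 one_pos).toMultiset = Q.toMultiset := by
  have h : (fun i => 1 * Q.N i) = Q.N := funext fun i => one_mul _
  change multisetSumset (Q.mult • Q.finite_H.toFinset.val)
    ((integerBox fun i => 1 * Q.N i).val.map fun n => ∑ i, n i • Q.v i) = _
  rw [h]
  rfl

theorem mem_dilate_of_le {ε ε' : ℝ} (hε : 0 < ε) (hε' : 0 < ε') (h : ε ≤ ε') {g : G}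
    (hg : g ∈ (Q.dilate ε hε).toMultiset) : g ∈ (Q.dilate ε' hε').toMultiset := by
  obtain ⟨a, ha, n, hn, rfl⟩ := (mem_toMultiset _ g).1 hg
  exact (mem_toMultiset _ _).2 ⟨a, ha, n, fun i =>
    (hn i).trans (mul_le_mul_of_nonneg_right h (Q.N_pos i).le), rfl⟩

theorem multisetAvg_toMultiset (F : G → ℂ) : multisetAvg Q.toMultiset F =
    𝔼 h ∈ Q.finite_H.toFinset, 𝔼 n ∈ integerBox Q.N, F (h + ∑ i, n i • Q.v i) := by
  rw [toMultiset, multisetAvg_sumset, multisetAvg_nsmul Q.mult_pos]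
  simp only [multisetAvg_finset_map]
  have := multisetAvg_finset_map Q.finite_H.toFinset id fun h =>
    𝔼 n ∈ integerBox Q.N, F (h + ∑ i, n i • Q.v i)
  rwa [Multiset.map_id] at this

/-- Averages over a coset progression are almost invariant under translation by elements of a
much smaller dilate. -/
theorem norm_multisetAvg_shift_le {t : ℝ} (ht : 0 < t) {s : G}
    (hs : s ∈ (Q.dilate t ht).toMultiset) (φ : G → ℂ) (hφ : ∀ g, ‖φ g‖ ≤ 1) :
    ‖multisetAvg Q.toMultiset (fun g => φ (g + s)) - multisetAvg Q.toMultiset φ‖ ≤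
      2 * (Q.rank * t) := by
  have key : ∃ a ∈ Q.H, ∃ m : Fin Q.rank → ℤ, (∀ i, |(m i : ℝ)| ≤ t * Q.N i) ∧
      a + ∑ i, m i • Q.v i = s := (mem_toMultiset _ s).1 hs
  obtain ⟨a, ha, m, hm, rfl⟩ := key
  have hne : Q.finite_H.toFinset.Nonempty := ⟨0, by simp⟩
  have h1 : multisetAvg Q.toMultiset (fun g => φ (g + (a + ∑ i, m i • Q.v i))) =
      𝔼 h ∈ Q.finite_H.toFinset, 𝔼 n ∈ integerBox Q.N, φ (h + ∑ i, (n + m) i • Q.v i) := by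
    rw [multisetAvg_toMultiset]
    -- The subgroup part of the shift is absorbed exactly; only the box part costs anything.
    refine Finset.expect_equiv (Equiv.addRight a) (fun h => ?_) fun h _ => ?_
    · simp only [Set.Finite.mem_toFinset, SetLike.mem_coe, Equiv.coe_addRight]
      exact (Q.H.add_mem_cancel_right ha).symm
    · refine Finset.expect_congr rfl fun n _ => ?_
      simp only [Equiv.coe_addRight, Pi.add_apply, add_smul, Finset.sum_add_distrib]
      congr 1
      abel
  change ‖multisetAvg Q.toMultiset (fun g => φ (g + (a + ∑ i, m i • Q.v i))) - _‖ ≤ _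
  rw [h1, multisetAvg_toMultiset, ← Finset.expect_sub_distrib]
  have hpos : (0 : ℝ) < Q.finite_H.toFinset.card := by exact_mod_cast hne.card_pos
  rw [Finset.expect_eq_sum_div_card, norm_div, RCLike.norm_natCast, div_le_iff₀ hpos]
  refine (norm_sum_le _ _).trans ((Finset.sum_le_sum fun h _ =>
    norm_expect_box_shift_le Q.N Q.N_pos m hm (fun n => φ (h + ∑ i, n i • Q.v i))
      fun n => hφ _).trans ?_)
  simp [mul_comm]

theorem mem_dilate_dilate {t u : ℝ} (ht : 0 < t) (hu : 0 < u) {g : G}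
    (hg : g ∈ (Q.dilate (t * u) (mul_pos ht hu)).toMultiset) :
    g ∈ ((Q.dilate t ht).dilate u hu).toMultiset := by
  obtain ⟨a, ha, m, hm, he⟩ := (mem_toMultiset _ _).1 hg
  refine (mem_toMultiset _ _).2 ⟨a, ha, m, fun i => (hm i).trans_eq ?_, he⟩
  change t * u * Q.N i = u * (t * Q.N i)
  ring

/-- The dyadic dilates of a coset progression, which decrease to its subgroup. -/
def dyadic (k : ℕ) : CosetProgression G := Q.dilate ((1 / 2) ^ k) (by positivity)

theorem exists_index_dyadic (k : ℕ) :
    ∃ (m : ℕ) (q : Fin (m + 1) → G), valueMultiset q = (Q.dyadic k).toMultiset :=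
  exists_valueMultiset_eq _ (toMultiset_ne_zero _)

def dyadicCard (k : ℕ) : ℕ := (Q.exists_index_dyadic k).choose

/-- An enumeration of the `k`-th dyadic dilate. -/
def dyadicIndex (k : ℕ) : Fin (Q.dyadicCard k + 1) → G :=
  (Q.exists_index_dyadic k).choose_spec.choose

theorem valueMultiset_dyadicIndex (k : ℕ) :
    valueMultiset (Q.dyadicIndex k) = (Q.dyadic k).toMultiset :=
  (Q.exists_index_dyadic k).choose_spec.choose_spec

theorem mem_range_dyadicIndex {k : ℕ} {g : G} :
    g ∈ Set.range (Q.dyadicIndex k) ↔ g ∈ (Q.dyadic k).toMultiset := by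
  rw [← mem_valueMultiset, valueMultiset_dyadicIndex]

theorem expect_dyadicIndex (k : ℕ) (φ : G → ℂ) :
    𝔼 j, φ (Q.dyadicIndex k j) = multisetAvg (Q.dyadic k).toMultiset φ := by
  rw [← multisetAvg_valueMultiset, valueMultiset_dyadicIndex]

theorem toMultiset_dyadic_zero : (Q.dyadic 0).toMultiset = Q.toMultiset :=
  Q.toMultiset_dilate_one

end CosetProgression

namespace SysSeq

variable {S : SysSeq.{u, v}}

/-- The scale of dyadic dilates of a sequence of coset progressions of bounded rank. -/
def progScale {r : ℕ} (Q : ∀ n, CosetProgression (S.G n)) (hQ : ∀ n, (Q n).rank ≤ r) :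
    S.Scale where
  J k n := Fin ((Q n).dyadicCard k + 1)
  q k n := (Q n).dyadicIndex k
  anti := by
    intro k l n hkl g hg
    exact (Q n).mem_range_dyadicIndex.2 ((Q n).mem_dilate_of_le _ _
      (pow_le_pow_of_le_one (by norm_num) (by norm_num) hkl) ((Q n).mem_range_dyadicIndex.1 hg))
  inv := by
    intro k η hη
    -- A shift from a dilate by `t` costs at most `2 * (rank * t)`; the `+ 1` avoids dividing by
    -- zero in rank zero.
    obtain ⟨l, hl⟩ := exists_pow_lt_of_lt_one (x := η / (2 * (r + 1))) (y := (1 / 2 : ℝ))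
      (by positivity) (by norm_num)
    refine ⟨k + l, fun n j φ hφ => ?_⟩
    rw [(Q n).expect_dyadicIndex k fun g => φ (g + (Q n).dyadicIndex (k + l) j),
      (Q n).expect_dyadicIndex k φ]
    have hj : (Q n).dyadicIndex (k + l) j ∈
        (((Q n).dilate ((1 / 2) ^ k) (by positivity)).dilate ((1 / 2) ^ l)
          (by positivity)).toMultiset := by
      refine (Q n).mem_dilate_dilate _ _ ?_
      have h1 := (Q n).mem_range_dyadicIndex.1 ⟨j, rfl⟩
      simpa only [CosetProgression.dyadic, pow_add] using h1
    refine (CosetProgression.norm_multisetAvg_shift_le _ _ hj φ hφ).trans ?_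
    have h2 : (((Q n).dilate ((1 / 2) ^ k) (by positivity)).rank : ℝ) ≤ r := by
      exact_mod_cast hQ n
    rw [lt_div_iff₀ (by positivity)] at hl
    have h4 : (0 : ℝ) < (1 / 2) ^ l := by positivity
    nlinarith

theorem valueMultiset_progScale {r : ℕ} (Q : ∀ n, CosetProgression (S.G n))
    (hQ : ∀ n, (Q n).rank ≤ r) (n : ℕ) :
    valueMultiset ((progScale Q hQ).q 0 n) = (Q n).toMultiset :=
  ((Q n).valueMultiset_dyadicIndex 0).trans (Q n).toMultiset_dyadic_zero

theorem inf_progScale {r : ℕ} (Q : ∀ n, CosetProgression (S.G n)) (hQ : ∀ n, (Q n).rank ≤ r)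
    {ε : ℕ → ℝ} (hε : ∀ n, 0 < ε n) (hlim : Tendsto ε limitFilter (𝓝 0)) {s : ∀ n, S.G n}
    (hs : ∀ n, s n ∈ ((Q n).dilate (ε n) (hε n)).toMultiset) : (progScale Q hQ).Inf s := by
  intro k
  filter_upwards [hlim.eventually_lt_const (by positivity : (0 : ℝ) < (1 / 2) ^ k)] with n hn
  exact (Q n).mem_range_dyadicIndex.2 ((Q n).mem_dilate_of_le _ _ hn.le (hs n))

end SysSeq

/-! ### Normalization of Gowers norms and bounded representatives -/

theorem norm_multisetAvg_le_one {G : Type*} {A : Multiset G} {F : G → ℂ} (hF : ∀ g, ‖F g‖ ≤ 1) :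
    ‖multisetAvg A F‖ ≤ 1 := by
  have h : ∀ A : Multiset G, ‖(A.map F).sum‖ ≤ Multiset.card A := by
    intro A
    induction A using Multiset.induction with
    | empty => simp
    | cons a A ih =>
      simp only [Multiset.map_cons, Multiset.sum_cons, Multiset.card_cons]
      push_cast
      exact (norm_add_le _ _).trans (by linarith [hF a])
  rw [multisetAvg, norm_div, RCLike.norm_natCast]
  exact div_le_one_of_le₀ (h A) (Nat.cast_nonneg _)

section GowersNorm

variable {G : Type*} [AddCommGroup G] {X : Type*} [AddAction G X] [MeasurableSpace X]
  {μ : Measure X}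

theorem gowersAvg_congr_ae (hμ : IsGSystem G μ) (Q : Multiset G) (d : ℕ) {f f' : X → ℂ}
    (h : f =ᵐ[μ] f') : gowersAvg μ Q d f = gowersAvg μ Q d f' := by
  induction d generalizing f f' with
  | zero => exact integral_congr_ae h
  | succ d ih =>
    refine congrArg (multisetAvg Q) (funext fun g => congrArg (multisetAvg Q)
      (funext fun g' => ih ?_))
    have key : ∀ s : G, sysTranslate s f =ᵐ[μ] sysTranslate s f' := fun s =>
      (hμ.measurePreserving (-s)).quasiMeasurePreserving.ae_eq_comp h
    filter_upwards [key g, key g'] with x h1 h2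
    simp only [multDeriv, h1, h2]

theorem gowersNorm_congr_ae (hμ : IsGSystem G μ) (Q : Multiset G) (d : ℕ) {f f' : X → ℂ}
    (h : f =ᵐ[μ] f') : gowersNorm μ Q d f = gowersNorm μ Q d f' := by
  rw [gowersNorm, gowersNorm, gowersAvg_congr_ae hμ Q d h]

theorem gowersNorm_nonneg (hμ : IsGSystem G μ) (Q : Multiset G) {d : ℕ} (hd : 1 ≤ d) {f : X → ℂ}
    (hf : MemLp f ⊤ μ) : 0 ≤ gowersNorm μ Q d f := by
  obtain ⟨a, ha, h⟩ := gowersAvg_nonneg hμ Q d hd f hf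
  rw [gowersNorm, h]
  exact Real.rpow_nonneg ha _

theorem norm_gowersAvg_eq (hμ : IsGSystem G μ) (Q : Multiset G) {d : ℕ} (hd : 1 ≤ d) {f : X → ℂ}
    (hf : MemLp f ⊤ μ) : ‖gowersAvg μ Q d f‖ = gowersNorm μ Q d f ^ 2 ^ d := by
  obtain ⟨a, ha, h⟩ := gowersAvg_nonneg hμ Q d hd f hf
  rw [gowersNorm, h, Complex.ofReal_re, Complex.norm_real, Real.norm_of_nonneg ha,
    ← Real.rpow_natCast, ← Real.rpow_mul ha]
  simp

theorem norm_gowersAvg_le_one [IsProbabilityMeasure μ] (Q : Multiset G) (d : ℕ) {f : X → ℂ}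
    (hf : ∀ x, ‖f x‖ ≤ 1) : ‖gowersAvg μ Q d f‖ ≤ 1 := by
  induction d generalizing f with
  | zero =>
    have := norm_integral_le_of_norm_le_const (μ := μ) (Eventually.of_forall hf)
    simpa [gowersAvg] using this
  | succ d ih =>
    exact norm_multisetAvg_le_one fun g => norm_multisetAvg_le_one fun g' => ih fun x =>
      (norm_multDeriv_le hf g g' x).trans (by norm_num)

theorem gowersNorm_le_one (hμ : IsGSystem G μ) (Q : Multiset G) {d : ℕ} (hd : 1 ≤ d) {f : X → ℂ}
    (hf : MemLp f ⊤ μ) (hf1 : ∀ x, ‖f x‖ ≤ 1) : gowersNorm μ Q d f ≤ 1 := by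
  have := hμ.isProbabilityMeasure
  have h := norm_gowersAvg_le_one (μ := μ) Q d hf1
  rw [norm_gowersAvg_eq hμ Q hd hf] at h
  exact (pow_le_one_iff_of_nonneg (gowersNorm_nonneg hμ Q hd hf) (by positivity)).1 h

theorem exists_measurable_bounded {f : X → ℂ} (hf : AEStronglyMeasurable f μ)
    (hf1 : eLpNorm f ⊤ μ ≤ 1) : ∃ f' : X → ℂ, Measurable f' ∧ (∀ x, ‖f' x‖ ≤ 1) ∧ f =ᵐ[μ] f' := by
  obtain ⟨g, hg, hfg⟩ := hf
  refine ⟨fun x => if ‖g x‖ ≤ 1 then g x else 0, ?_, fun x => ?_, ?_⟩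
  · exact Measurable.ite (measurableSet_le hg.measurable.norm measurable_const) hg.measurable
      measurable_const
  · dsimp only
    split_ifs with h
    · exact h
    · simp
  · rw [eLpNorm_exponent_top] at hf1
    filter_upwards [hfg, ae_le_eLpNormEssSup (f := f) (μ := μ)] with x hx h1
    have h2 : ‖g x‖ ≤ 1 := by
      rw [← hx]
      have h3 := h1.trans hf1
      rw [← ofReal_norm, ENNReal.ofReal_le_one] at h3
      exact h3
    rw [if_pos h2, hx]

theorem memLp_top_of_bounded [IsProbabilityMeasure μ] {f : X → ℂ} (hf : Measurable f)
    (hf1 : ∀ x, ‖f x‖ ≤ 1) : MemLp f ⊤ μ :=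
  memLp_top_of_bound hf.aestronglyMeasurable 1 (Eventually.of_forall hf1)

end GowersNorm

/-! ### Random selection of finitely many indices -/

section Selection

variable {ι I : Type*} [Fintype ι] [DecidableEq ι] [Fintype I] [Nonempty I]

theorem expect_apply (a : ι) (g : I → ℝ) : 𝔼 i : ι → I, g (i a) = 𝔼 x, g x := by
  rw [Fintype.expect_equiv (Equiv.funSplitAt a I) (fun i => g (i a)) (fun p => g p.1)
    fun i => rfl, expect_prod]
  simp

/-- Two distinct coordinates of a uniformly random tuple are independent and uniform. -/
theorem expect_apply_apply {a b : ι} (hab : a ≠ b) (v : I × I → ℝ) :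
    𝔼 i : ι → I, v (i a, i b) = 𝔼 p, v p := by
  rw [Fintype.expect_equiv (Equiv.funSplitAt a I) (fun i => v (i a, i b))
    (fun p => v (p.1, p.2 ⟨b, hab.symm⟩)) fun i => rfl, expect_prod, expect_prod]
  exact Finset.expect_congr rfl fun x _ => expect_apply (⟨b, hab.symm⟩ : {j // j ≠ a})
    fun y => v (x, y)

/-- From a large average of `u` and a small average of `v` one extracts `m` indices at which `u` is
large on average and `v` is small on all pairs. -/
theorem exists_selection {u : I → ℝ} (hu0 : ∀ i, 0 ≤ u i) (hu1 : ∀ i, u i ≤ 1) {v : I × I → ℝ}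
    (hv : ∀ p, 0 ≤ v p) {ε : ℝ} (hε : 0 < ε) (h : 𝔼 p, v p ≤ ε) (m : ℕ) :
    ∃ i : Fin m → I, m * (𝔼 x, u x) - m ^ 2 * √ε ≤ ∑ a, u (i a) ∧
      ∀ a b, a ≠ b → v (i a, i b) ≤ √ε * (m + m ^ 2 * √ε) := by
  set t := √ε
  have ht : 0 < t := Real.sqrt_pos.2 hε
  have htt : t * t = ε := Real.mul_self_sqrt hε.le
  set W : (Fin m → I) → ℝ := fun i => ∑ a, ∑ b, if a ≠ b then v (i a, i b) else 0
  -- The penalty `W / √ε` has mean at most `m ^ 2 * √ε`. A tuple at least as good as the mean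
  -- therefore has large `∑ u`, and `∑ u ≤ m` bounds its `W`, hence every `v` on distinct positions.
  obtain ⟨i, hi⟩ := exists_expect_le_real fun i : Fin m → I => (∑ a, u (i a)) - t⁻¹ * W i
  have hW : 𝔼 i, W i ≤ m ^ 2 * ε := by
    simp only [W, Finset.expect_sum_comm]
    have h1 : ∀ a b : Fin m, (𝔼 i : Fin m → I, if a ≠ b then v (i a, i b) else 0) ≤ ε := by
      intro a b
      by_cases hab : a = b
      · simp [hab, hε.le]
      · simp only [ne_eq, hab, not_false_eq_true, if_true]
        rwa [expect_apply_apply hab]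
    refine (Finset.sum_le_sum fun a _ => Finset.sum_le_sum fun b _ => h1 a b).trans_eq ?_
    simp
    ring
  have hE : 𝔼 i : Fin m → I, ((∑ a, u (i a)) - t⁻¹ * W i) =
      m * (𝔼 x, u x) - t⁻¹ * 𝔼 i, W i := by
    rw [Finset.expect_sub_distrib, Finset.expect_sum_comm, ← Finset.mul_expect]
    simp only [expect_apply, Finset.sum_const, Finset.card_univ, Fintype.card_fin, nsmul_eq_mul]
  have h2 : t⁻¹ * 𝔼 i, W i ≤ m ^ 2 * t := by
    rw [inv_mul_le_iff₀ ht]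
    calc _ ≤ _ := hW
      _ = _ := by rw [← htt]; ring
  rw [hE] at hi
  have hterm : ∀ a b, 0 ≤ if a ≠ b then v (i a, i b) else 0 := fun a b => by
    split_ifs
    · exact hv _
    · exact le_rfl
  have hW0 : 0 ≤ W i := Finset.sum_nonneg fun a _ => Finset.sum_nonneg fun b _ => hterm a b
  have hW1 : 0 ≤ t⁻¹ * W i := by positivity
  refine ⟨i, by linarith, fun a b hab => ?_⟩
  have h3 : v (i a, i b) ≤ W i := by
    have h4 := Finset.single_le_sum (f := fun b => if a ≠ b then v (i a, i b) else 0)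
      (fun b _ => hterm a b) (Finset.mem_univ b)
    have h5 := Finset.single_le_sum
      (f := fun a => ∑ b, if a ≠ b then v (i a, i b) else 0)
      (fun a _ => Finset.sum_nonneg fun b _ => hterm a b) (Finset.mem_univ a)
    simp only [ne_eq, hab, not_false_eq_true, if_true] at h4
    exact h4.trans h5
  have h6 : ∑ a, u (i a) ≤ m := by
    refine (Finset.sum_le_sum fun a _ => hu1 (i a)).trans ?_
    simp
  have h7 : 0 ≤ m * (𝔼 x, u x) :=
    mul_nonneg (Nat.cast_nonneg _) (Finset.expect_nonneg fun x _ => hu0 x)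
  have h8 : t⁻¹ * W i ≤ m + m ^ 2 * t := by linarith
  rw [inv_mul_le_iff₀ ht] at h8
  exact h3.trans h8

end Selection

/-! ### Compactness: the Bessel inequality for a fixed number of progressions -/

set_option linter.checkUnivs false in
/-- A system with a bounded function and `m` coset progressions of rank at most `r`. -/
structure BesselConfig (r m : ℕ) where
  G : Type u
  X : Type v
  [instG : AddCommGroup G]
  [instM : MeasurableSpace X]
  [instA : AddAction G X]
  μ : Measure X
  sys : IsGSystem G μ
  Q : Fin m → CosetProgression G
  rank_le : ∀ a, (Q a).rank ≤ r
  f : X → ℂ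
  measurable_f : Measurable f
  norm_f_le : ∀ x, ‖f x‖ ≤ 1
  ε : ℝ
  ε_pos : 0 < ε

namespace BesselConfig

attribute [instance] BesselConfig.instG BesselConfig.instM BesselConfig.instA

variable {r m : ℕ}

/-- The Gowers average along one of the progressions. -/
def avg (C : BesselConfig.{u, v} r m) (d : ℕ) (a : Fin m) : ℂ :=
  gowersAvg C.μ (C.Q a).toMultiset d C.f

/-- The Gowers average along the sum of two dilated progressions. -/
def pairAvg (C : BesselConfig.{u, v} r m) (d : ℕ) (a b : Fin m) : ℂ :=
  gowersAvg C.μ (multisetSumset ((C.Q a).dilate C.ε C.ε_pos).toMultiset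
    ((C.Q b).dilate C.ε C.ε_pos).toMultiset) d C.f

/-- The ultrafilter limit of these sums is at most 1 by `sum_norm_sq_le`, so some stage lies below
2. Since `ε → 0`, elements of the dilates `εQ` are infinitesimal for the dyadic scale of `Q`. -/
theorem exists_sum_norm_sq_lt (D : ℕ) (C : ℕ → BesselConfig.{u, v} r m)
    (hε : Tendsto (fun n => (C n).ε) atTop (𝓝 0))
    (hC : ∀ a b, a ≠ b → Tendsto (fun n => (C n).pairAvg (D + D + 1) a b) atTop (𝓝 0)) :
    ∃ n, ∑ a, ‖(C n).avg (D + 1) a‖ ^ 2 < 2 := by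
  have hle : limitFilter ≤ atTop := by
    rw [← Nat.cofinite_eq_atTop]
    exact hyperfilter_le_cofinite
  let S : SysSeq.{u, v} :=
    { G := fun n => (C n).G, X := fun n => (C n).X, μ := fun n => (C n).μ, sys := fun n => (C n).sys }
  let f : S.BF := SysSeq.BF.mk (fun n => (C n).f) (fun n => (C n).measurable_f) 1
    fun n => (C n).norm_f_le
  let σ : Fin m → S.Scale := fun a =>
    SysSeq.progScale (S := S) (fun n => (C n).Q a) fun n => (C n).rank_le a
  have hex : ∀ (a : Fin m) (n : ℕ), ∃ (k : ℕ) (q : Fin (k + 1) → (C n).G),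
      valueMultiset q = (((C n).Q a).dilate (C n).ε (C n).ε_pos).toMultiset := fun a n =>
    exists_valueMultiset_eq _ (CosetProgression.toMultiset_ne_zero _)
  choose k q hq using hex
  have hmem : ∀ (a : Fin m) (n : ℕ) (j : Fin (k a n + 1)),
      q a n j ∈ (((C n).Q a).dilate (C n).ε (C n).ε_pos).toMultiset := fun a n j => by
    rw [← hq, mem_valueMultiset]
    exact ⟨j, rfl⟩
  have key := SysSeq.Scale.sum_norm_sq_le (S := S) (D := D) σ f (fun n => (C n).norm_f_le)
    (J := fun a b n => Fin (k a n + 1) × Fin (k b n + 1))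
    (fun a b n p => q a n p.1 + q b n p.2)
    (fun a b j => SysSeq.Scale.Inf.sum
      (SysSeq.inf_progScale (S := S) _ _ (fun n => (C n).ε_pos) (hε.mono_left hle)
        fun n => hmem a n (j n).1)
      (SysSeq.inf_progScale (S := S) _ _ (fun n => (C n).ε_pos) (hε.mono_left hle)
        fun n => hmem b n (j n).2))
    (fun a b hab => by
      refine ((hC a b hab).mono_left hle).congr fun n => ?_
      rw [pairAvg, ← hq a n, ← hq b n, multisetSumset_valueMultiset]
      rfl)
  have hlim : Tendsto (fun n => ∑ a, ‖(C n).avg (D + 1) a‖ ^ 2) limitFilter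
      (𝓝 (∑ a, ‖inner ℂ (SysSeq.BF.dual ((σ a).q 0) (D + 1) f) f‖ ^ 2)) := by
    refine tendsto_finsetSum _ fun a _ => ((Tendsto.congr (fun n => ?_)
      (SysSeq.BF.tendsto_gowersAvg ((σ a).q 0) (D + 1) f)).norm.pow 2)
    have h := SysSeq.valueMultiset_progScale (S := S) (fun n => (C n).Q a)
      (fun n => (C n).rank_le a) n
    exact congrArg (fun A => gowersAvg (C n).μ A (D + 1) (C n).f) h
  exact (hlim.eventually_lt_const (key.trans_lt one_lt_two)).exists

theorem exists_sum_norm_sq_le (r m D : ℕ) : ∃ η : ℝ, 0 < η ∧ ∀ C : BesselConfig.{u, v} r m,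
    C.ε ≤ η → (∀ a b, a ≠ b → ‖C.pairAvg (D + D + 1) a b‖ ≤ η) →
      ∑ a, ‖C.avg (D + 1) a‖ ^ 2 < 2 := by
  by_contra! hcon
  choose C h1 h2 h3 using fun n : ℕ => hcon (1 / ((n : ℝ) + 1)) (by positivity)
  have h0 := tendsto_one_div_add_atTop_nhds_zero_nat (𝕜 := ℝ)
  obtain ⟨n, hn⟩ := exists_sum_norm_sq_lt D C (squeeze_zero (fun n => (C n).ε_pos.le) h1 h0)
    fun a b hab => squeeze_zero_norm (fun n => h2 n a b hab) h0
  exact absurd (h3 n) (not_le.2 hn)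

end BesselConfig

/-! ### Families of arbitrary size -/

/-- The power mean inequality: a mean of at least `t` would force the sum of `(k + 1)`-th powers to
be at least `m * t ^ (k + 1) ≥ 2`. -/
theorem lt_of_sum_pow_lt {m k : ℕ} {u : Fin m → ℝ} (hu : ∀ a, 0 ≤ u a) {t : ℝ} (ht : 0 < t)
    (hm : 2 ≤ m * t ^ (k + 1)) (h : ∑ a, u a ^ (k + 1) < 2) : ∑ a, u a < m * t := by
  by_contra! hcon
  have hm0 : 0 < (m : ℝ) := by
    rcases Nat.eq_zero_or_pos m with rfl | hpos
    · norm_num at hm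
    · exact_mod_cast hpos
  have h1 := pow_sum_div_card_le_sum_pow (s := Finset.univ) (fun a _ => hu a) k
  rw [Finset.card_univ, Fintype.card_fin, div_le_iff₀ (by positivity)] at h1
  have h2 := pow_le_pow_left₀ (by positivity) hcon (k + 1)
  have h3 : (∑ a, u a ^ (k + 1)) * (m : ℝ) ^ k < m * t ^ (k + 1) * m ^ k :=
    mul_lt_mul_of_pos_right (h.trans_le hm) (by positivity)
  have h4 : (m * t : ℝ) ^ (k + 1) = m * t ^ (k + 1) * m ^ k := by ring
  linarith

theorem exists_expect_gowersNorm_le (r : ℕ) {d : ℕ} (hd : 1 ≤ d) {δ : ℝ} (hδ : 0 < δ) :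
    ∃ ε₀ : ℝ, 0 < ε₀ ∧ ∀ {G : Type u} [AddCommGroup G] {X : Type v} [MeasurableSpace X]
      [AddAction G X] (μ : Measure X) (_ : IsGSystem G μ) {I : Type w} [Fintype I] [Nonempty I]
      (Q : I → CosetProgression G) (_ : ∀ i, (Q i).rank ≤ r)
      (f : X → ℂ) (_ : Measurable f) (_ : ∀ x, ‖f x‖ ≤ 1) (ε : ℝ) (hε : 0 < ε) (_ : ε < ε₀)
      (_ : 𝔼 p : I × I, gowersNorm μ (multisetSumset ((Q p.1).dilate ε hε).toMultiset
        ((Q p.2).dilate ε hε).toMultiset) (2 * d - 1) f ≤ ε),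
      𝔼 i : I, gowersNorm μ (Q i).toMultiset d f ≤ δ := by
  obtain ⟨D, rfl⟩ : ∃ D, d = D + 1 := ⟨d - 1, by omega⟩
  -- The squared Gowers average is the norm to the power `2 ^ (D + 1) * 2`.
  obtain ⟨k, hk⟩ : ∃ k, 2 ^ (D + 1) * 2 = k + 1 :=
    ⟨2 ^ (D + 1) * 2 - 1, by have := Nat.one_le_two_pow (n := D + 1); omega⟩
  -- The number of sampled indices depends only on `δ` and the degree, which makes `ε₀` independent
  -- of the family.
  obtain ⟨m, hm⟩ := exists_nat_ge (2 / (δ / 2) ^ (k + 1))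
  rw [div_le_iff₀ (by positivity)] at hm
  obtain ⟨η, hη, H⟩ := BesselConfig.exists_sum_norm_sq_le.{u, v} r m D
  have hlim1 : Tendsto (fun ε : ℝ => (m : ℝ) * √ε) (𝓝 0) (𝓝 0) := by
    have : Continuous fun ε : ℝ => (m : ℝ) * √ε := by fun_prop
    simpa using this.tendsto 0
  have hlim2 : Tendsto (fun ε : ℝ => √ε * (m + m ^ 2 * √ε)) (𝓝 0) (𝓝 0) := by
    have : Continuous fun ε : ℝ => √ε * (m + m ^ 2 * √ε) := by fun_prop
    simpa using this.tendsto 0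
  obtain ⟨ε₀, hε₀, hball⟩ := Metric.eventually_nhds_iff.1 ((hlim1.eventually_lt_const
    (half_pos hδ)).and (hlim2.eventually_lt_const hη))
  refine ⟨min ε₀ η, lt_min hε₀ hη, ?_⟩
  intro G _ X _ _ μ hμ I _ _ Q hQ f hf hf1 ε hε hεlt hhyp
  have := hμ.isProbabilityMeasure
  have hLp : MemLp f ⊤ μ := memLp_top_of_bounded hf hf1
  obtain ⟨hs1, hs2⟩ := hball (y := ε) (by
    rw [Real.dist_eq, sub_zero, abs_of_pos hε]
    exact hεlt.trans_le (min_le_left _ _))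
  have e1 : 2 * (D + 1) - 1 = D + D + 1 := by omega
  rw [e1] at hhyp
  obtain ⟨i, hi1, hi2⟩ := exists_selection
    (fun i => gowersNorm_nonneg hμ (Q i).toMultiset hd hLp)
    (fun i => gowersNorm_le_one hμ (Q i).toMultiset hd hLp hf1)
    (fun p => gowersNorm_nonneg hμ _ (by omega) hLp) hε hhyp m
  let C : BesselConfig.{u, v} r m :=
    { G := G, X := X, μ := μ, sys := hμ, Q := fun a => Q (i a), rank_le := fun a => hQ (i a),
      f := f, measurable_f := hf, norm_f_le := hf1, ε := ε, ε_pos := hε }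
  have hsum := H C (hεlt.le.trans (min_le_right _ _)) fun a b hab => by
    change ‖gowersAvg μ (multisetSumset ((Q (i a)).dilate ε hε).toMultiset
      ((Q (i b)).dilate ε hε).toMultiset) (D + D + 1) f‖ ≤ η
    rw [norm_gowersAvg_eq hμ _ (by omega) hLp]
    refine (pow_le_of_le_one (gowersNorm_nonneg hμ _ (by omega) hLp)
      (gowersNorm_le_one hμ _ (by omega) hLp hf1) (by positivity)).trans ?_
    exact (hi2 a b hab).trans hs2.le
  have hsum' : ∑ a, gowersNorm μ (Q (i a)).toMultiset (D + 1) f ^ (k + 1) < 2 := by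
    refine lt_of_eq_of_lt (Finset.sum_congr rfl fun a _ => ?_) hsum
    change _ = ‖gowersAvg μ (Q (i a)).toMultiset (D + 1) f‖ ^ 2
    rw [norm_gowersAvg_eq hμ _ hd hLp, ← pow_mul, hk]
  have hlt := lt_of_sum_pow_lt (fun a => gowersNorm_nonneg hμ (Q (i a)).toMultiset hd hLp)
    (half_pos hδ) hm hsum'
  have hm0 : 0 < (m : ℝ) := by
    by_contra hcon
    have : (m : ℝ) = 0 := le_antisymm (not_lt.1 hcon) (Nat.cast_nonneg _)
    rw [this] at hm
    norm_num at hm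
  by_contra! hcon
  -- Half of `δ` comes from the sampled norms and the other half from the sampling loss `m * √ε`.
  nlinarith

/-- The values of the left-hand side of the Bessel inequality at the parameter `ε`. -/
def besselValues (r d : ℕ) (ε : ℝ) : Set ℝ :=
  {y | ∃ (hε : 0 < ε) (G : Type u) (_ : AddCommGroup G) (X : Type v) (_ : MeasurableSpace X)
    (_ : AddAction G X) (μ : Measure X) (_ : IsGSystem G μ) (I : Type w) (_ : Fintype I)
    (_ : Nonempty I) (Q : I → CosetProgression G) (_ : ∀ i, (Q i).rank ≤ r) (f : X → ℂ)
    (_ : Measurable f) (_ : ∀ x, ‖f x‖ ≤ 1)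
    (_ : 𝔼 p : I × I, gowersNorm μ (multisetSumset ((Q p.1).dilate ε hε).toMultiset
      ((Q p.2).dilate ε hε).toMultiset) (2 * d - 1) f ≤ ε),
    y = 𝔼 i : I, gowersNorm μ (Q i).toMultiset d f}

theorem besselValues_subset_Icc (r : ℕ) {d : ℕ} (hd : 1 ≤ d) (ε : ℝ) :
    besselValues.{u, v, w} r d ε ⊆ Set.Icc 0 1 := by
  rintro y ⟨hε, G, _, X, _, _, μ, hμ, I, _, _, Q, hQ, f, hf, hf1, -, rfl⟩
  have := hμ.isProbabilityMeasure
  have hLp : MemLp f ⊤ μ := memLp_top_of_bounded hf hf1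
  exact ⟨Finset.expect_nonneg fun i _ => gowersNorm_nonneg hμ _ hd hLp,
    Finset.expect_le Finset.univ_nonempty fun i _ => gowersNorm_le_one hμ _ hd hLp hf1⟩

/-- The threshold `ε₀` for each `δ` is uniform over all systems and families, so the supremum over
them tends to zero. -/
theorem tendsto_sSup_besselValues (r : ℕ) {d : ℕ} (hd : 1 ≤ d) :
    Tendsto (fun ε => sSup (besselValues.{u, v, w} r d ε)) (𝓝[>] 0) (𝓝 0) := by
  refine tendsto_order.2 ⟨fun a ha => Eventually.of_forall fun ε => ha.trans_le
    (Real.sSup_nonneg fun y hy => (besselValues_subset_Icc r hd ε hy).1), fun a ha => ?_⟩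
  obtain ⟨ε₀, hε₀, H⟩ := exists_expect_gowersNorm_le.{u, v, w} r hd (half_pos ha)
  filter_upwards [Ioo_mem_nhdsGT hε₀] with ε hε
  refine lt_of_le_of_lt (Real.sSup_le ?_ (half_pos ha).le) (half_lt_self ha)
  rintro y ⟨hε', G, _, X, _, _, μ, hμ, I, _, _, Q, hQ, f, hf, hf1, h, rfl⟩
  exact H μ hμ Q hQ f hf hf1 ε hε' hε.2 h

end

theorem theorem1p16 (r d : ℕ) (hd : 1 ≤ d) :
    ∃ c : ℝ → ℝ, (∀ ε, 0 < ε → 0 < c ε) ∧ Tendsto c (𝓝[>] 0) (𝓝 0) ∧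
      ∀ {G : Type*} [AddCommGroup G] {X : Type*} [MeasurableSpace X] [AddAction G X]
        (μ : Measure X) (_ : IsGSystem G μ)
        {I : Type*} [Fintype I] [Nonempty I]
        (Q : I → CosetProgression G) (_ : ∀ i, (Q i).rank ≤ r)
        (f : X → ℂ) (_ : AEStronglyMeasurable f μ) (_ : eLpNorm f ⊤ μ ≤ 1)
        (ε : ℝ) (hε : 0 < ε)
        (_ : 𝔼 p : I × I,
          gowersNorm μ (multisetSumset ((Q p.1).dilate ε hε).toMultiset
            ((Q p.2).dilate ε hε).toMultiset) (2 * d - 1) f ≤ ε),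
        𝔼 i : I, gowersNorm μ (Q i).toMultiset d f ≤ c ε := by
  -- Adding `ε` keeps `c` positive where the supremum is zero.
  refine ⟨fun ε => sSup (besselValues r d ε) + ε, fun ε hε => ?_, ?_, ?_⟩
  · exact add_pos_of_nonneg_of_pos
      (Real.sSup_nonneg fun y hy => (besselValues_subset_Icc r hd ε hy).1) hε
  · simpa using (tendsto_sSup_besselValues r hd).add
      (tendsto_nhdsWithin_of_tendsto_nhds tendsto_id)
  · intro G _ X _ _ μ hμ I _ _ Q hQ f hf hf1 ε hε h
    obtain ⟨f', hf', hf1', hff'⟩ := exists_measurable_bounded hf hf1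
    simp only [gowersNorm_congr_ae hμ _ _ hff'] at h ⊢
    have hmem : 𝔼 i : I, gowersNorm μ (Q i).toMultiset d f' ∈ besselValues r d ε :=
      ⟨hε, G, inferInstance, X, inferInstance, inferInstance, μ, hμ, I, inferInstance,
        inferInstance, Q, hQ, f', hf', hf1', h, rfl⟩
    have := le_csSup ⟨1, fun y hy => (besselValues_subset_Icc r hd ε hy).2⟩ hmem
    linarith
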